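/- Let $k$ be a field, $S=k[x_1,\dots,x_n]$, let $\mathfrak a\subseteq\langle x_1,\dots,x_n\rangle$ be an ideal of $S$ and $A=S/\mathfrak a$, so that $k\cong A/\langle x_1,\dots,x_n\rangle$. Let $\prec$ be the degree-lexicographic order with $x_1\succ\dots\succ x_n$, let $\mathrm{in}(\mathfrak a)$ be the initial ideal, $\mathrm{MinGen}(\mathrm{in}(\mathfrak a))$ its minimal monomial generating set, and $\mathcal G$ the set of standard monomials (monomials not in $\mathrm{in}(\mathfrak a)$) of degree $\ge 1$. A monomial is called reducible if it lies in $\mathrm{in}(\mathfrak a)$. For a monomial $w\ne 1$ put $m(w)=\min\{i : x_i\mid w\}$. *Minimal fully attached tuples* are tuples of elements of $\mathcal G$ defined recursively. A pair $(w_1,w_2)$ is minimal fully attached if $w_1=x_{m(w_1w_2)}$ and $w_1w_2\in\mathrm{MinGen}(\mathrm{in}(\mathfrak a))$. For $l>2$, a tuple $(w_1,\dots,w_l)$ is minimal fully attached if $(w_1,\dots,w_{l-1})$ is, $m(w_1)<m(w_l)$, and $w=w_l$ satisfies one of the following two conditions while no proper divisor of $w_l$ satisfies either of them: 1. $w_{l-1}w$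 is reducible; 2. $w_{l-1}w=uv\in\mathcal G$ for monomials $u,v$ such that $u\succ w_{l-1}$ and $(w_1,\dots,w_{l-2},u)$ is minimal fully attached. Let $\mathcal L$ be the set of all finite words (including the empty one) whose letters are minimal fully attached tuples and in which a letter with first entry $x_i$ is never immediately followed by a letter with first entry $x_j\prec x_i$. For $w\in\mathcal L$ let $|w|$ be the total number of entries of all its letters, let $x^{w}$ be the product of all these entries, and put $$F(x,t)=\sum_{w\in\mathcal L}x^{w}\,t^{|w|}.$$ (a) If $\mathfrak a$ is homogeneous for the multigrading $\deg x_i=e_i\in\mathbb N^n$, then all $\operatorname{Tor}^A_i(k,k)_\alpha$ are finite-dimensional and the multigraded Poincaré–Betti series satisfies, coefficientwise, $$\sum_{i\ge 0,\ \alpha\in\mathbb N^n}\dim_k\operatorname{Tor}^A_i(k,k)_\alpha\,x^\alpha t^i\ \le\ \prod_{i=1}^n(1+x_it)\cdot F(x,t).$$ (b) More generally, write $\prod_{i=1}^n(1+x_it)\,F(x,t)=\sum_{i,\alpha} c_{i,\alpha}x^\alpha t^i$. For each $i$ only finitely many $c_{i,\alpha}$ are nonzero. If $\Gamma$ is a commutative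 (additive) monoid, $d_1,\dots,d_n\in\Gamma$, and $\mathfrak a$ is homogeneous for the $\Gamma$-grading $\deg x_j=d_j$, then for all $i\ge 0$ and $\gamma\in\Gamma$ $$\dim_k\operatorname{Tor}^A_i(k,k)_\gamma\ \le\ \sum_{\alpha\in\mathbb N^n:\ \alpha_1d_1+\dots+\alpha_nd_n=\gamma}c_{i,\alpha}.$$ In particular (trivial $\Gamma$), for every $\mathfrak a\subseteq\langle x_1,\dots,x_n\rangle$ the Betti numbers are bounded by $\dim_k\operatorname{Tor}^A_i(k,k)\le\sum_\alpha c_{i,\alpha}$. Here $\operatorname{Tor}^A_i(k,k)_\gamma$ is the degree-$\gamma$ part of $H_i(k\otimes_A F_\bullet)$ for any graded free resolution $F_\bullet$ of $k$ over $A$; the inequalities are asserted for every such resolution. -/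

import Mathlib

open MvPolynomial TensorProduct
open scoped MonomialOrder

universe u v w

namespace AnickCommutative

/-! ### Standard monomials and the initial ideal

Monomials of `S = k[x_0, …, x_{n-1}]` are identified with their exponent vectors
`Fin n →₀ ℕ`; thus `0` is the monomial `1`, `+` is multiplication, and `≤` is divisibility.
The monomial order is degree-lex with `x_0 ≻ x_1 ≻ ⋯ ≻ x_{n-1}`. -/

section Monomials

variable {k : Type u} [Field k] {n : ℕ}

/-- The monomials lying in the initial ideal of `a` with respect to degree-lex. Over a field
these are exactly the leading monomials of the nonzero elements of `a`. A monomial is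
reducible iff it lies in this set. -/
def initialMonomials (a : Ideal (MvPolynomial (Fin n) k)) : Set (Fin n →₀ ℕ) :=
  {w | ∃ f ∈ a, f ≠ 0 ∧ MonomialOrder.degLex.degree f = w}

/-- The minimal monomial generating system of the initial ideal of `a`. -/
def minGenInitial (a : Ideal (MvPolynomial (Fin n) k)) : Set (Fin n →₀ ℕ) :=
  {w | Minimal (fun v => v ∈ initialMonomials a) w}

/-- The standard monomials of degree at least `1`. -/
def standardMonomials (a : Ideal (MvPolynomial (Fin n) k)) : Set (Fin n →₀ ℕ) :=
  {w | w ≠ 0 ∧ w ∉ initialMonomials a}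

/-! ### Minimal fully attached tuples -/

/-- The two alternatives in the definition of a minimal fully attached tuple
`(pre, b, c)`: either `b * c` is reducible, or `b * c = u * v` is standard with `u ≻ b` and
`(pre, u)` satisfies `prev`, where `prev` stands for being minimal fully attached and one entry
shorter. -/
def AttachingCondition (a : Ideal (MvPolynomial (Fin n) k))
    (prev : List (Fin n →₀ ℕ) → Prop) (pre : List (Fin n →₀ ℕ)) (b c : Fin n →₀ ℕ) : Prop :=
  b + c ∈ initialMonomials a ∨
    (b + c ∈ standardMonomials a ∧
      ∃ u v : Fin n →₀ ℕ, b + c = u + v ∧ b ≺[MonomialOrder.degLex] u ∧ prev (pre ++ [u]))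

/-- `IsMinFullyAttachedOfLength a l t`: the list `t` is a minimal fully attached `l`-tuple of
standard monomials (there are none for `l ≤ 1`).

* A pair is minimal fully attached iff it is `(x_i, w₂)` with `x_i w₂` a minimal generator of the
  initial ideal and `i` the smallest index of a variable dividing `x_i w₂`.
* A tuple `(x_i, w₂, …, b, c)` with at least three entries is minimal fully attached iff
  `(x_i, w₂, …, b)` is, all variables dividing `c` have index larger than `i`, and `c` is minimal
  for divisibility among the monomials that satisfy the attaching condition. -/
def IsMinFullyAttachedOfLength (a : Ideal (MvPolynomial (Fin n) k)) :
    ℕ → List (Fin n →₀ ℕ) → Prop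
  | 0, _ => False
  | 1, _ => False
  | 2, t => ∃ (i : Fin n) (w₂ : Fin n →₀ ℕ), t = [Finsupp.single i 1, w₂] ∧
      Finsupp.single i 1 ∈ standardMonomials a ∧ w₂ ∈ standardMonomials a ∧
      Finsupp.single i 1 + w₂ ∈ minGenInitial a ∧ ∀ j ∈ w₂.support, i ≤ j
  | l + 3, t => ∃ (pre : List (Fin n →₀ ℕ)) (b c : Fin n →₀ ℕ), t = pre ++ [b, c] ∧
      IsMinFullyAttachedOfLength a (l + 2) (pre ++ [b]) ∧
      c ∈ standardMonomials a ∧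
      (∃ i : Fin n, pre.head? = some (Finsupp.single i 1) ∧ ∀ j ∈ c.support, i < j) ∧
      AttachingCondition a (IsMinFullyAttachedOfLength a (l + 2)) pre b c ∧
      ∀ c' : Fin n →₀ ℕ, c' ≤ c → c' ≠ c →
        ¬ AttachingCondition a (IsMinFullyAttachedOfLength a (l + 2)) pre b c'

/-- Minimal fully attached tuples, of any length. -/
def IsMinFullyAttached (a : Ideal (MvPolynomial (Fin n) k)) (t : List (Fin n →₀ ℕ)) : Prop :=
  IsMinFullyAttachedOfLength a t.length t

/-! ### The language and its counting series -/

/-- The forbidden two-letter words: `[x_i|…][x_j|…]` with `x_j ≺ x_i`. -/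
def Forbidden (p q : List (Fin n →₀ ℕ)) : Prop :=
  ∃ (x y : Fin n →₀ ℕ) (s t : List (Fin n →₀ ℕ)),
    p = x :: s ∧ q = y :: t ∧ y ≺[MonomialOrder.degLex] x

/-- The words over the alphabet of minimal fully attached tuples without forbidden
two-letter subword. A word is a list of letters, and a letter is a list of monomials. -/
def language (a : Ideal (MvPolynomial (Fin n) k)) : Set (List (List (Fin n →₀ ℕ))) :=
  {W | (∀ p ∈ W, IsMinFullyAttached a p) ∧ W.IsChain (fun p q => ¬ Forbidden p q)}

/-- A word read as a monomial: the product of all entries of all letters. -/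
noncomputable def wordMonomial (W : List (List (Fin n →₀ ℕ))) : Fin n →₀ ℕ :=
  (W.map List.sum).sum

/-- The length of a word: the total number of entries of its letters, which is the homological
degree of the corresponding element `[w₁|w₂|…]` of the bar resolution. -/
def wordLength (W : List (List (Fin n →₀ ℕ))) : ℕ :=
  (W.map List.length).sum

/-- `F(x,t) = ∑_W W t^{|W|}` over the words of the language, as a power series in `t` over the
power series in `x_0, …, x_{n-1}`. There are only finitely many words with a given monomial. -/
noncomputable def wordSeries (a : Ideal (MvPolynomial (Fin n) k)) :
    PowerSeries (MvPowerSeries (Fin n) ℕ) :=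
  PowerSeries.mk fun l => fun α =>
    Nat.card {W // W ∈ language a ∧ wordMonomial W = α ∧ wordLength W = l}

/-- `∏ (1 + x_i t) · F(x,t)`. -/
noncomputable def boundSeries (a : Ideal (MvPolynomial (Fin n) k)) :
    PowerSeries (MvPowerSeries (Fin n) ℕ) :=
  (∏ i : Fin n, (1 + PowerSeries.C (MvPowerSeries.X i) * PowerSeries.X)) * wordSeries a

end Monomials

/-! ### Graded `Tor`

`A` is a commutative `k`-algebra graded by the family `𝒜 : Γ → Submodule k A`, and `𝔪` is an ideal
of `A`. The quotient `A ⧸ 𝔪` is regarded as an `A`-module concentrated in degree `0`. -/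

section GradedTor

variable {k : Type u} [Field k] {A : Type u} [CommRing A] [Algebra k A]
  {Γ : Type w} [AddCommMonoid Γ]

/-- The degree-`γ` part of the free `A`-module with basis `(e_b)_b`, where `e_b` has degree
`deg b`: it is spanned by the `r e_b` with `r ∈ A_δ` and `δ + deg b = γ`. -/
noncomputable def freeComponent (𝒜 : Γ → Submodule k A) {ι : Type v} (deg : ι → Γ) (γ : Γ) :
    Submodule k (ι →₀ A) :=
  Submodule.span k {x | ∃ (b : ι) (δ : Γ) (r : A),
    r ∈ 𝒜 δ ∧ δ + deg b = γ ∧ x = Finsupp.single b r}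

/-- A `Γ`-graded free resolution `⋯ → F₂ → F₁ → F₀ → A ⧸ 𝔪 → 0` over `A`, with homogeneous bases
indexed by `basis i` and maps of degree `0`. -/
structure GradedFreeResolution (𝒜 : Γ → Submodule k A) (𝔪 : Ideal A) where
  /-- index set of the basis of `F_i` -/
  basis : ℕ → Type v
  /-- degrees of the basis elements -/
  deg : ∀ i, basis i → Γ
  /-- the differential `F_{i+1} → F_i` -/
  diff : ∀ i, (basis (i + 1) →₀ A) →ₗ[A] (basis i →₀ A)
  /-- the augmentation `F₀ → A ⧸ 𝔪` -/
  aug : (basis 0 →₀ A) →ₗ[A] A ⧸ 𝔪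
  diff_homogeneous : ∀ i γ, ∀ x ∈ freeComponent 𝒜 (deg (i + 1)) γ,
    diff i x ∈ freeComponent 𝒜 (deg i) γ
  aug_homogeneous : ∀ γ, γ ≠ 0 → ∀ x ∈ freeComponent 𝒜 (deg 0) γ, aug x = 0
  aug_surjective : Function.Surjective aug
  exact_zero : Function.Exact (diff 0) aug
  exact_succ : ∀ i, Function.Exact (diff (i + 1)) (diff i)

namespace GradedFreeResolution

variable {𝒜 : Γ → Submodule k A} {𝔪 : Ideal A}

/-- The module `(A ⧸ 𝔪) ⊗_A F_i`. -/
abbrev Tensored (R : GradedFreeResolution.{u, v, w} 𝒜 𝔪) (i : ℕ) : Type (max u v) :=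
  (A ⧸ 𝔪) ⊗[A] (R.basis i →₀ A)

/-- The degree-`γ` part of `(A ⧸ 𝔪) ⊗_A F_i`: the image of the degree-`γ` part of `F_i`. -/
noncomputable def tensorComponent (R : GradedFreeResolution.{u, v, w} 𝒜 𝔪) (i : ℕ) (γ : Γ) :
    Submodule k (R.Tensored i) :=
  (freeComponent 𝒜 (R.deg i) γ).map
    ((TensorProduct.mk A (A ⧸ 𝔪) (R.basis i →₀ A) 1).restrictScalars k)

/-- The differential `(A ⧸ 𝔪) ⊗_A F_{i+1} → (A ⧸ 𝔪) ⊗_A F_i`. -/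
noncomputable def tensorDiff (R : GradedFreeResolution.{u, v, w} 𝒜 𝔪) (i : ℕ) :
    R.Tensored (i + 1) →ₗ[k] R.Tensored i :=
  ((R.diff i).lTensor (A ⧸ 𝔪)).restrictScalars k

/-- The `i`-cycles of `(A ⧸ 𝔪) ⊗_A F` of degree `γ`. -/
noncomputable def cycles (R : GradedFreeResolution.{u, v, w} 𝒜 𝔪) :
    (i : ℕ) → (γ : Γ) → Submodule k (R.Tensored i)
  | 0, γ => R.tensorComponent 0 γ
  | i + 1, γ => R.tensorComponent (i + 1) γ ⊓ LinearMap.ker (R.tensorDiff i)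

/-- The `i`-boundaries of `(A ⧸ 𝔪) ⊗_A F` of degree `γ`. -/
noncomputable def boundaries (R : GradedFreeResolution.{u, v, w} 𝒜 𝔪) (i : ℕ) (γ : Γ) :
    Submodule k (R.Tensored i) :=
  (R.tensorComponent (i + 1) γ).map (R.tensorDiff i)

/-- `Tor^A_i(A ⧸ 𝔪, A ⧸ 𝔪)_γ`, the degree-`γ` part of the homology `H_i((A ⧸ 𝔪) ⊗_A F)`:
cycles modulo boundaries, realized as the image of the cycles in the quotient of
`(A ⧸ 𝔪) ⊗_A F_i` by the boundaries (every boundary is a cycle). -/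
abbrev Tor (R : GradedFreeResolution.{u, v, w} 𝒜 𝔪) (i : ℕ) (γ : Γ) : Type (max u v) :=
  ↥((R.cycles i γ).map (R.boundaries i γ).mkQ)

end GradedFreeResolution

/-- The multigraded Poincaré–Betti series `∑ dim_k Tor^A_i(A ⧸ 𝔪, A ⧸ 𝔪)_α x^α t^i`. -/
noncomputable def poincareSeries {n : ℕ} {𝒜 : (Fin n →₀ ℕ) → Submodule k A} {𝔪 : Ideal A}
    (R : GradedFreeResolution.{u, v, 0} 𝒜 𝔪) : PowerSeries (MvPowerSeries (Fin n) ℕ) :=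
  PowerSeries.mk fun i => fun α => Module.finrank k (R.Tor i α)

end GradedTor

/-! ### The algebra `A = S / a` -/

section Quotient

variable {k : Type u} [Field k] {n : ℕ} {Γ : Type w} [AddCommMonoid Γ]

/-- `a` is homogeneous for the grading `deg x_i = d i` of the polynomial ring by `Γ`. -/
def IsHomogeneousFor (d : Fin n → Γ) (a : Ideal (MvPolynomial (Fin n) k)) : Prop :=
  ∀ f ∈ a, ∀ γ : Γ, weightedHomogeneousComponent d γ f ∈ a

/-- The natural multigrading `deg x_i = e_i ∈ ℕ^n`. -/
noncomputable def naturalDegree (n : ℕ) : Fin n → (Fin n →₀ ℕ) :=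
  fun i => Finsupp.single i 1

/-- The degree-`γ` part of `A = S / a`, for the grading `deg x_i = d i`. -/
noncomputable def algComponent (d : Fin n → Γ) (a : Ideal (MvPolynomial (Fin n) k)) (γ : Γ) :
    Submodule k (MvPolynomial (Fin n) k ⧸ a) :=
  (weightedHomogeneousSubmodule k d γ).map (Ideal.Quotient.mkₐ k a).toLinearMap

/-- The ideal of `A = S / a` generated by the residue classes of the variables. The residue class
field is `A ⧸ augIdeal a`, which is `k` if `a ⊆ ⟨x_0, …, x_{n-1}⟩`. -/
noncomputable def augIdeal (a : Ideal (MvPolynomial (Fin n) k)) :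
    Ideal (MvPolynomial (Fin n) k ⧸ a) :=
  (idealOfVars (Fin n) k).map (Ideal.Quotient.mk a)

end Quotient

end AnickCommutative

/-! The standard monomials form a `k`-basis of `A`. Starting from the maximal ideal, the letters
that may be appended to a cell generate, modulo the initial ideal, the colon ideal of the last
letter by the initial ideal and the letters with priority over it. So every monomial of a colon
ideal factors uniquely as a letter times a standard monomial outside the next colon ideal, and
correcting leading terms lifts these factorizations to a graded free resolution of the residue
field whose `i`-th module has the cells of length `i` as its basis. Comparing resolutions bounds
`dim Tor_i(k, k)_γ` by the number of cells of length `i` and degree `γ`.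

For the letters defined by minimal fully attached tuples, a cell is a sequence of blocks, each a
single variable or a minimal fully attached tuple. Along the sequence the first entries weakly
increase, and strictly after a single variable. A cell is thus determined by the set of variables
that are blocks, which accounts for `∏ (1 + x_i t)`, and the word of its longer blocks, which lies
in the language counted by `F(x, t)`. -/

namespace AnickCommutative

/-! ### Residue classes of monomials -/

section ResidueMonomials

variable {k : Type u} [Field k] {n : ℕ} {Γ : Type w} [AddCommMonoid Γ]
  {a : Ideal (MvPolynomial (Fin n) k)} {d : Fin n → Γ}

theorem add_mem_initialMonomials {w : Fin n →₀ ℕ} (hw : w ∈ initialMonomials a)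
    (v : Fin n →₀ ℕ) : w + v ∈ initialMonomials a := by
  obtain ⟨f, hf, hf₀, rfl⟩ := hw
  have hm : monomial v (1 : k) ≠ 0 := by simp
  refine ⟨f * monomial v 1, a.mul_mem_right _ hf, mul_ne_zero hf₀ hm, ?_⟩
  classical
  rw [MonomialOrder.degree_mul hf₀ hm, MonomialOrder.degree_monomial, if_neg one_ne_zero]

theorem mem_initialMonomials_of_le {w v : Fin n →₀ ℕ} (hw : w ∈ initialMonomials a)
    (h : w ≤ v) : v ∈ initialMonomials a := by
  obtain ⟨u, rfl⟩ := exists_add_of_le h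
  exact add_mem_initialMonomials hw u

/-- The residue class of a monomial in the quotient algebra `S ⧸ a`. -/
noncomputable def residueMonomial (a : Ideal (MvPolynomial (Fin n) k)) (w : Fin n →₀ ℕ) :
    MvPolynomial (Fin n) k ⧸ a :=
  Ideal.Quotient.mk a (monomial w 1)

theorem residueMonomial_zero : residueMonomial a 0 = 1 := by
  rw [residueMonomial, monomial_zero', C_1, map_one]

theorem residueMonomial_add (v w : Fin n →₀ ℕ) :
    residueMonomial a (v + w) = residueMonomial a v * residueMonomial a w := by
  rw [residueMonomial, residueMonomial, residueMonomial, ← map_mul, monomial_mul, one_mul]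

theorem mk_monomial (v : Fin n →₀ ℕ) (c : k) :
    Ideal.Quotient.mk a (monomial v c) = c • residueMonomial a v := by
  rw [residueMonomial, ← Ideal.Quotient.mkₐ_eq_mk k, ← map_smul, smul_monomial, smul_eq_mul,
    mul_one]

theorem mk_eq_sum_residueMonomial (f : MvPolynomial (Fin n) k) :
    Ideal.Quotient.mk a f = ∑ v ∈ f.support, coeff v f • residueMonomial a v := by
  conv_lhs => rw [f.as_sum, map_sum]
  exact Finset.sum_congr rfl fun v _ => mk_monomial v _

theorem span_range_residueMonomial :
    Submodule.span k (Set.range (residueMonomial a)) = ⊤ := by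
  refine eq_top_iff.2 fun x _ => ?_
  obtain ⟨f, rfl⟩ := Ideal.Quotient.mk_surjective x
  rw [mk_eq_sum_residueMonomial]
  exact Submodule.sum_mem _ fun v _ => Submodule.smul_mem _ _ (Submodule.subset_span ⟨v, rfl⟩)

theorem residueMonomial_mem_algComponent (d : Fin n → Γ) (w : Fin n →₀ ℕ) :
    residueMonomial a w ∈ algComponent d a (Finsupp.weight d w) :=
  ⟨monomial w 1, isWeightedHomogeneous_monomial d w 1 rfl, rfl⟩

theorem residueMonomial_mem_span_lt (hd : IsHomogeneousFor d a)
    {w : Fin n →₀ ℕ} (hw : w ∈ initialMonomials a) :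
    residueMonomial a w ∈ Submodule.span k (residueMonomial a ''
      {v | v ≺[MonomialOrder.degLex] w ∧ Finsupp.weight d v = Finsupp.weight d w}) := by
  classical
  obtain ⟨f, hf, hf₀, rfl⟩ := hw
  set w := MonomialOrder.degLex.degree f
  set g := weightedHomogeneousComponent d (Finsupp.weight d w) f with hg
  have hgw : coeff w g ≠ 0 := by
    rw [hg, coeff_weightedHomogeneousComponent, if_pos rfl]
    exact MonomialOrder.coeff_degree_ne_zero_iff.2 hf₀
  have hsum : coeff w g • residueMonomial a w +
      ∑ v ∈ g.support.erase w, coeff v g • residueMonomial a v = 0 := by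
    rw [Finset.add_sum_erase _ (fun v => coeff v g • residueMonomial a v)
      (mem_support_iff.2 hgw), ← mk_eq_sum_residueMonomial]
    exact Ideal.Quotient.eq_zero_iff_mem.2 (hd f hf _)
  rw [← Submodule.smul_mem_iff _ hgw, eq_neg_of_add_eq_zero_left hsum]
  refine Submodule.neg_mem _ (Submodule.sum_mem _ fun v hv =>
    Submodule.smul_mem _ _ (Submodule.subset_span ⟨v, ?_, rfl⟩))
  obtain ⟨hvw, hv⟩ := Finset.mem_erase.1 hv
  rw [mem_support_iff, hg, coeff_weightedHomogeneousComponent, ite_ne_right_iff] at hv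
  exact ⟨lt_of_le_of_ne (MonomialOrder.le_degree (mem_support_iff.2 hv.2)) fun h =>
    hvw (MonomialOrder.degLex.toSyn.injective h), hv.1⟩

theorem residueMonomial_mem_span_irreducible (hd : IsHomogeneousFor d a) (w : Fin n →₀ ℕ) :
    residueMonomial a w ∈ Submodule.span k (residueMonomial a ''
      {v | v ∉ initialMonomials a ∧ (v = w ∨ v ≺[MonomialOrder.degLex] w ∧
        Finsupp.weight d v = Finsupp.weight d w)}) := by
  have hwf : WellFounded fun v w : Fin n →₀ ℕ => v ≺[MonomialOrder.degLex] w :=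
    InvImage.wf MonomialOrder.degLex.toSyn wellFounded_lt
  induction w using hwf.induction with
  | _ w ih =>
    by_cases hw : w ∈ initialMonomials a
    · refine (Submodule.span_le.2 ?_) (residueMonomial_mem_span_lt hd hw)
      rintro _ ⟨v, ⟨hv, hvw⟩, rfl⟩
      refine Submodule.span_mono (Set.image_mono ?_) (ih v hv)
      rintro u ⟨hu, rfl | ⟨huv, huw⟩⟩
      · exact ⟨hu, Or.inr ⟨hv, hvw⟩⟩
      · exact ⟨hu, Or.inr ⟨huv.trans hv, huw.trans hvw⟩⟩
    · exact Submodule.subset_span ⟨w, ⟨hw, Or.inl rfl⟩, rfl⟩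

theorem IsHomogeneousFor.trivial (a : Ideal (MvPolynomial (Fin n) k)) :
    IsHomogeneousFor (fun _ => ()) a := by
  intro f hf γ
  suffices weightedHomogeneousComponent (fun _ : Fin n => ()) γ f = f by rwa [this]
  classical
  ext v
  rw [coeff_weightedHomogeneousComponent, if_pos (Subsingleton.elim _ _)]

theorem linearIndependent_residueMonomial :
    LinearIndependent k fun v : {v // v ∉ initialMonomials a} => residueMonomial a v := by
  classical
  rw [linearIndependent_iff']
  intro s g hg
  set f : MvPolynomial (Fin n) k := ∑ v ∈ s, monomial v.1 (g v) with hf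
  have hcoeff (u) : coeff u f = ∑ v ∈ s, if v.1 = u then g v else 0 := by
    simp only [hf, coeff_sum, coeff_monomial]
  have hfa : f ∈ a := by
    rw [← Ideal.Quotient.eq_zero_iff_mem, ← hg, hf, map_sum]
    exact Finset.sum_congr rfl fun v _ => mk_monomial v.1 (g v)
  have hf₀ : f = 0 := by
    by_contra hf₀
    refine MonomialOrder.coeff_degree_ne_zero_iff (m := MonomialOrder.degLex).2 hf₀ ?_
    rw [hcoeff]
    exact Finset.sum_eq_zero fun v _ => if_neg fun h => v.2 ⟨f, hfa, hf₀, h.symm⟩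
  intro v hv
  have hv₀ := hcoeff v.1
  rwa [hf₀, coeff_zero, Finset.sum_eq_single_of_mem v hv fun u _ huv =>
    if_neg (Subtype.coe_ne_coe.2 huv), if_pos rfl, eq_comm] at hv₀

theorem span_irreducible :
    Submodule.span k (Set.range fun v : {v // v ∉ initialMonomials a} => residueMonomial a v)
      = ⊤ := by
  rw [eq_top_iff, ← span_range_residueMonomial, Submodule.span_le]
  rintro _ ⟨w, rfl⟩
  refine Submodule.span_mono ?_
    (residueMonomial_mem_span_irreducible (IsHomogeneousFor.trivial a) w)
  rintro _ ⟨v, ⟨hv, -⟩, rfl⟩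
  exact ⟨⟨v, hv⟩, rfl⟩

/-- The `k`-basis of `S ⧸ a` formed by the irreducible monomials (Macaulay's theorem). -/
noncomputable def irreducibleBasis (a : Ideal (MvPolynomial (Fin n) k)) :
    Module.Basis {v // v ∉ initialMonomials a} k (MvPolynomial (Fin n) k ⧸ a) :=
  Module.Basis.mk linearIndependent_residueMonomial span_irreducible.ge

theorem irreducibleBasis_apply (v : {v // v ∉ initialMonomials a}) :
    irreducibleBasis a v = residueMonomial a v :=
  Module.Basis.mk_apply _ _ _

theorem coord_residueMonomial_self (v : {v // v ∉ initialMonomials a}) :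
    (irreducibleBasis a).coord v (residueMonomial a v) = 1 := by
  rw [← irreducibleBasis_apply, Module.Basis.coord_apply, Module.Basis.repr_self,
    Finsupp.single_eq_same]

theorem coord_residueMonomial_of_ne {u v : {v // v ∉ initialMonomials a}} (h : u ≠ v) :
    (irreducibleBasis a).coord v (residueMonomial a u) = 0 := by
  rw [← irreducibleBasis_apply, Module.Basis.coord_apply, Module.Basis.repr_self,
    Finsupp.single_eq_of_ne h.symm]

theorem eq_or_lt_of_coord_ne_zero (hd : IsHomogeneousFor d a)
    (v : {v // v ∉ initialMonomials a}) (w : Fin n →₀ ℕ)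
    (h : (irreducibleBasis a).coord v (residueMonomial a w) ≠ 0) :
    v.1 = w ∨ v.1 ≺[MonomialOrder.degLex] w ∧ Finsupp.weight d v.1 = Finsupp.weight d w := by
  contrapose! h
  refine LinearMap.mem_ker.1 ((Submodule.span_le.2 ?_ : _ ≤ LinearMap.ker _)
    (residueMonomial_mem_span_irreducible hd w))
  rintro _ ⟨u, ⟨hu, huw⟩, rfl⟩
  refine coord_residueMonomial_of_ne (u := ⟨u, hu⟩) ?_
  rintro rfl
  rcases huw with rfl | huw
  exacts [h.1 rfl, h.2 huw.1 huw.2]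

end ResidueMonomials

/-! ### Gradings of quotient algebras and of free modules -/

section MapDecomposition

open DirectSum

variable {R M N Γ : Type*} [CommRing R] [AddCommGroup M] [Module R M] [AddCommGroup N] [Module R N]
  [DecidableEq Γ] (ℳ : Γ → Submodule R M)

theorem coeLinearMap_lmap_submoduleMap (f : M →ₗ[R] N) (z : ⨁ γ, ℳ γ) :
    coeLinearMap (fun γ => (ℳ γ).map f) (lmap (fun γ => f.submoduleMap (ℳ γ)) z) =
      f (coeLinearMap ℳ z) := by
  induction z using DirectSum.induction_on with
  | zero => simp only [map_zero]
  | add z w hz hw => simp only [map_add, hz, hw]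
  | of γ z => rw [← lof_eq_of R, lmap_lof, coeLinearMap_lof, coeLinearMap_lof,
      LinearMap.submoduleMap_coe_apply]

/-- The images of the homogeneous components of `M` under a surjection with homogeneous kernel
decompose the target. -/
noncomputable abbrev mapDecomposition [Decomposition ℳ] (f : M →ₗ[R] N) (hf : Function.Surjective f)
    (hker : ∀ x, f x = 0 → ∀ γ, f (decompose ℳ x γ) = 0) :
    Decomposition fun γ => (ℳ γ).map f where
  decompose' y := lmap (fun γ => f.submoduleMap (ℳ γ)) (decompose ℳ (Function.surjInv hf y))
  left_inv y := by
    refine (coeLinearMap_lmap_submoduleMap ℳ f _).trans ?_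
    exact (congrArg f ((decompose ℳ).symm_apply_apply _)).trans (Function.surjInv_eq hf y)
  right_inv y := by
    obtain ⟨z, rfl⟩ := (lmap_surjective _).2 (fun γ => f.submoduleMap_surjective (ℳ γ)) y
    obtain ⟨x, rfl⟩ := (decompose ℳ).surjective z
    have hcoe : DirectSum.coeAddMonoidHom (fun γ => (ℳ γ).map f)
        (lmap (fun γ => f.submoduleMap (ℳ γ)) (decompose ℳ x)) = f x :=
      (coeLinearMap_lmap_submoduleMap ℳ f _).trans
        (congrArg f ((decompose ℳ).symm_apply_apply x))
    rw [hcoe]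
    refine (lmap_eq_iff _ _ _).2 fun γ => Subtype.ext (sub_eq_zero.1 ?_)
    have hx : f (Function.surjInv hf (f x) - x) = 0 := by
      rw [map_sub, Function.surjInv_eq hf, sub_self]
    simpa only [decompose_sub, DirectSum.sub_apply, AddSubgroupClass.coe_sub, map_sub,
      LinearMap.submoduleMap_coe_apply]
      using hker _ hx γ

end MapDecomposition

section QuotientGrading

variable {k : Type u} [Field k] {n : ℕ} {Γ : Type w} [AddCommMonoid Γ]
  {a : Ideal (MvPolynomial (Fin n) k)} {d : Fin n → Γ}

instance algComponent_gradedMonoid : SetLike.GradedMonoid (algComponent d a) where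
  one_mem := ⟨1, isWeightedHomogeneous_one k d, map_one (Ideal.Quotient.mkₐ k a)⟩
  mul_mem := by
    rintro δ ε _ _ ⟨f, hf, rfl⟩ ⟨g, hg, rfl⟩
    exact ⟨f * g, IsWeightedHomogeneous.mul hf hg, map_mul (Ideal.Quotient.mkₐ k a) f g⟩

/-- The grading of `S ⧸ a` by the residue classes of weighted homogeneous polynomials. -/
noncomputable abbrev algComponentDecomposition [DecidableEq Γ] (hd : IsHomogeneousFor d a) :
    DirectSum.Decomposition (algComponent d a) :=
  letI := weightedDecomposition k d
  mapDecomposition (weightedHomogeneousSubmodule k d) (Ideal.Quotient.mkₐ k a).toLinearMap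
    Ideal.Quotient.mk_surjective fun f hf γ => by
      change Ideal.Quotient.mk a ((weightedDecomposition k d).decompose' f γ) = 0
      rw [weightedDecomposition.decompose'_apply]
      exact Ideal.Quotient.eq_zero_iff_mem.2 (hd f (Ideal.Quotient.eq_zero_iff_mem.1 hf) γ)

end QuotientGrading

section FreeGrading

variable {k : Type u} [Field k] {A : Type u} [CommRing A] [Algebra k A]
  {Γ : Type w} [AddCommMonoid Γ] {𝒜 : Γ → Submodule k A} {ι κ : Type*}

theorem single_mem_freeComponent (deg : ι → Γ) (b : ι) {δ : Γ} {r : A}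
    (hr : r ∈ 𝒜 δ) : Finsupp.single b r ∈ freeComponent 𝒜 deg (δ + deg b) :=
  Submodule.subset_span ⟨b, δ, r, hr, rfl, rfl⟩

section GradedMonoid

variable [SetLike.GradedMonoid 𝒜]

theorem smul_mem_freeComponent (deg : ι → Γ) {δ γ : Γ} {r : A} {x : ι →₀ A}
    (hr : r ∈ 𝒜 δ) (hx : x ∈ freeComponent 𝒜 deg γ) :
    r • x ∈ freeComponent 𝒜 deg (δ + γ) := by
  induction hx using Submodule.span_induction with
  | mem x hx =>
    obtain ⟨b, ε, s, hs, rfl, rfl⟩ := hx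
    rw [Finsupp.smul_single, smul_eq_mul, ← add_assoc]
    exact single_mem_freeComponent deg b (SetLike.GradedMul.mul_mem hr hs)
  | zero => rw [smul_zero]; exact Submodule.zero_mem _
  | add x y _ _ hx hy => rw [smul_add]; exact Submodule.add_mem _ hx hy
  | smul c x _ hx => rw [smul_comm]; exact Submodule.smul_mem _ _ hx

theorem single_one_mem_freeComponent (deg : ι → Γ) (b : ι) :
    Finsupp.single b (1 : A) ∈ freeComponent 𝒜 deg (deg b) := by
  simpa only [zero_add] using
    single_mem_freeComponent (𝒜 := 𝒜) deg b SetLike.GradedOne.one_mem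

/-- A map of degree `0` between graded free modules. -/
def IsHomogeneousMap (𝒜 : Γ → Submodule k A) (deg : ι → Γ) (deg' : κ → Γ)
    (f : (ι →₀ A) →ₗ[A] (κ →₀ A)) : Prop :=
  ∀ γ, ∀ x ∈ freeComponent 𝒜 deg γ, f x ∈ freeComponent 𝒜 deg' γ

theorem isHomogeneousMap_of_basis {deg : ι → Γ} {deg' : κ → Γ} {f : (ι →₀ A) →ₗ[A] (κ →₀ A)}
    (hf : ∀ b, f (Finsupp.single b 1) ∈ freeComponent 𝒜 deg' (deg b)) :
    IsHomogeneousMap 𝒜 deg deg' f := by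
  intro γ x hx
  induction hx using Submodule.span_induction with
  | mem x hx =>
    obtain ⟨b, ε, s, hs, rfl, rfl⟩ := hx
    rw [← mul_one s, ← smul_eq_mul, ← Finsupp.smul_single, map_smul]
    exact smul_mem_freeComponent deg' hs (hf b)
  | zero => rw [map_zero]; exact Submodule.zero_mem _
  | add x y _ _ hx hy => rw [map_add]; exact Submodule.add_mem _ hx hy
  | smul c x _ hx => rw [LinearMap.map_smul_of_tower]; exact Submodule.smul_mem _ _ hx

end GradedMonoid

section Decomposition

open DirectSum

variable [DecidableEq Γ] (𝒜) [Decomposition 𝒜]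

/-- Splits an element of a graded free module into its homogeneous components. -/
noncomputable def freeDecompose (deg : ι → Γ) : (ι →₀ A) →ₗ[k] ⨁ γ, freeComponent 𝒜 deg γ :=
  Finsupp.lsum k fun b => DirectSum.toModule k Γ _ (fun δ =>
    DirectSum.lof k Γ (fun γ => freeComponent 𝒜 deg γ) (δ + deg b) ∘ₗ
      (Finsupp.lsingle b).restrict fun _ hr => single_mem_freeComponent deg b hr) ∘ₗ
    (decomposeLinearEquiv 𝒜).toLinearMap

theorem freeDecompose_single (deg : ι → Γ) (b : ι) {δ : Γ} {r : A} (hr : r ∈ 𝒜 δ) :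
    freeDecompose 𝒜 deg (Finsupp.single b r) =
      lof k Γ (fun γ => freeComponent 𝒜 deg γ) (δ + deg b)
        ⟨_, single_mem_freeComponent deg b hr⟩ := by
  rw [freeDecompose, Finsupp.lsum_single, LinearMap.comp_apply, LinearEquiv.coe_coe,
    decomposeLinearEquiv_apply, decompose_of_mem _ hr, ← lof_eq_of k, toModule_lof]
  rfl

theorem freeDecompose_of_mem (deg : ι → Γ) {γ : Γ} {x : ι →₀ A}
    (hx : x ∈ freeComponent 𝒜 deg γ) :
    freeDecompose 𝒜 deg x = lof k Γ (fun γ => freeComponent 𝒜 deg γ) γ ⟨x, hx⟩ := by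
  induction hx using Submodule.span_induction with
  | mem x hx =>
    obtain ⟨b, δ, r, hr, rfl, rfl⟩ := hx
    exact freeDecompose_single 𝒜 deg b hr
  | zero => rw [map_zero]; exact (map_zero _).symm
  | add x y hx hy ihx ihy => rw [map_add, ihx, ihy, ← map_add]; rfl
  | smul c x hx ih => rw [map_smul, ih, ← map_smul]; rfl

noncomputable instance freeDecomposition (deg : ι → Γ) :
    Decomposition (freeComponent 𝒜 deg) :=
  Decomposition.ofLinearMap _ (freeDecompose 𝒜 deg)
    (by
      ext b r : 2
      induction r using Decomposition.inductionOn 𝒜 with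
      | zero => simp only [map_zero]
      | add r s hr hs => rw [map_add, map_add, hr, hs]
      | homogeneous r =>
        simp only [LinearMap.comp_apply, Finsupp.lsingle_apply, freeDecompose_single 𝒜 deg b r.2,
          coeLinearMap_lof, LinearMap.id_apply])
    (by
      ext γ x : 2
      simp only [LinearMap.comp_apply, coeLinearMap_lof, LinearMap.id_apply,
        freeDecompose_of_mem 𝒜 deg x.2])

variable {𝒜}

theorem IsHomogeneousMap.decompose_apply {deg : ι → Γ} {deg' : κ → Γ}
    {f : (ι →₀ A) →ₗ[A] (κ →₀ A)} (hf : IsHomogeneousMap 𝒜 deg deg' f) (x : ι →₀ A) (γ : Γ) :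
    (decompose (freeComponent 𝒜 deg') (f x) γ : κ →₀ A) =
      f (decompose (freeComponent 𝒜 deg) x γ) := by
  induction x using Decomposition.inductionOn (freeComponent 𝒜 deg) with
  | zero => simp only [map_zero, decompose_zero, DirectSum.zero_apply, ZeroMemClass.coe_zero]
  | add x y hx hy =>
    simp only [map_add, decompose_add, DirectSum.add_apply, Submodule.coe_add, hx, hy]
  | @homogeneous δ x =>
    by_cases h : δ = γ
    · subst h
      rw [decompose_of_mem_same _ x.2, decompose_of_mem_same _ (hf _ _ x.2)]
    · rw [decompose_of_mem_ne _ x.2 h, decompose_of_mem_ne _ (hf _ _ x.2) h, map_zero]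

theorem IsHomogeneousMap.exists_homogeneous_eq {deg : ι → Γ} {deg' : κ → Γ}
    {f : (ι →₀ A) →ₗ[A] (κ →₀ A)} (hf : IsHomogeneousMap 𝒜 deg deg' f) {γ : Γ} {y : κ →₀ A}
    (hy : y ∈ freeComponent 𝒜 deg' γ) (h : y ∈ LinearMap.range f) :
    ∃ x ∈ freeComponent 𝒜 deg γ, f x = y := by
  obtain ⟨x, rfl⟩ := h
  refine ⟨decompose (freeComponent 𝒜 deg) x γ, SetLike.coe_mem _, ?_⟩
  rw [← hf.decompose_apply, decompose_of_mem_same _ hy]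

end Decomposition

end FreeGrading

/-! ### Comparison of graded free resolutions -/

theorem exists_dependent_sequence {T : ℕ → Type*} (Q : ∀ i, T i → T (i + 1) → Prop)
    {t₀ : T 0} {t₁ : T 1} (h₀ : Q 0 t₀ t₁)
    (step : ∀ i x y, Q i x y → ∃ z, Q (i + 1) y z) :
    ∃ t : ∀ i, T i, t 0 = t₀ ∧ ∀ i, Q i (t i) (t (i + 1)) := by
  choose next hnext using fun i (p : {p : T i × T (i + 1) // Q i p.1 p.2}) =>
    step i p.1.1 p.1.2 p.2
  let pairs (i : ℕ) : {p : T i × T (i + 1) // Q i p.1 p.2} :=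
    Nat.rec ⟨(t₀, t₁), h₀⟩ (fun i p => ⟨(p.1.2, next i p), hnext i p⟩) i
  exact ⟨fun i => (pairs i).1.1, rfl, fun i => (pairs i).2⟩

namespace GradedFreeResolution

universe v₁ v₂

variable {k : Type u} [Field k] {A : Type u} [CommRing A] [Algebra k A]
  {Γ : Type w} [AddCommMonoid Γ] {𝒜 : Γ → Submodule k A} {𝔪 : Ideal A}
  (R : GradedFreeResolution.{u, v₁, w} 𝒜 𝔪) (P : GradedFreeResolution.{u, v₂, w} 𝒜 𝔪)

theorem diff_diff (i : ℕ) (x) : R.diff i (R.diff (i + 1) x) = 0 :=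
  (R.exact_succ i).apply_apply_eq_zero x

section Lifting

variable [DecidableEq Γ] [DirectSum.Decomposition 𝒜]

open DirectSum in
theorem aug_decompose_zero (x : R.basis 0 →₀ A) :
    R.aug (decompose (freeComponent 𝒜 (R.deg 0)) x 0) = R.aug x := by
  induction x using Decomposition.inductionOn (freeComponent 𝒜 (R.deg 0)) with
  | zero => simp only [decompose_zero, DirectSum.zero_apply, ZeroMemClass.coe_zero]
  | add x y hx hy => simp only [map_add, decompose_add, DirectSum.add_apply, Submodule.coe_add,
      hx, hy]
  | @homogeneous γ x =>
    by_cases h : γ = 0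
    · subst h
      rw [decompose_of_mem_same _ x.2]
    · rw [decompose_of_mem_ne _ x.2 h, map_zero, R.aug_homogeneous γ h _ x.2]

theorem exists_homogeneous_aug_eq (y : A ⧸ 𝔪) :
    ∃ x ∈ freeComponent 𝒜 (R.deg 0) 0, R.aug x = y := by
  obtain ⟨x, rfl⟩ := R.aug_surjective y
  exact ⟨_, SetLike.coe_mem _, R.aug_decompose_zero x⟩

variable [SetLike.GradedMonoid 𝒜] {R P}

theorem exists_lift {ι : Type v₁} {deg : ι → Γ} {i : ℕ}
    {f : (ι →₀ A) →ₗ[A] (P.basis i →₀ A)} (hf : IsHomogeneousMap 𝒜 deg (P.deg i) f)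
    (h : LinearMap.range f ≤ LinearMap.range (P.diff i)) :
    ∃ g : (ι →₀ A) →ₗ[A] (P.basis (i + 1) →₀ A),
      IsHomogeneousMap 𝒜 deg (P.deg (i + 1)) g ∧ P.diff i ∘ₗ g = f := by
  choose g hg hgf using fun b => IsHomogeneousMap.exists_homogeneous_eq (P.diff_homogeneous i)
    (hf _ _ (single_one_mem_freeComponent deg b)) (h ⟨_, rfl⟩)
  refine ⟨Finsupp.linearCombination A g, isHomogeneousMap_of_basis fun b => ?_, ?_⟩
  · simpa using hg b
  · ext b : 2
    simp [hgf]

variable (R P) in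
theorem exists_lift_aug :
    ∃ g : (R.basis 0 →₀ A) →ₗ[A] (P.basis 0 →₀ A),
      IsHomogeneousMap 𝒜 (R.deg 0) (P.deg 0) g ∧ P.aug ∘ₗ g = R.aug := by
  have h (b) : ∃ x ∈ freeComponent 𝒜 (P.deg 0) (R.deg 0 b),
      P.aug x = R.aug (Finsupp.single b 1) := by
    by_cases hb : R.deg 0 b = 0
    · rw [hb]
      exact P.exists_homogeneous_aug_eq _
    · refine ⟨0, Submodule.zero_mem _, ?_⟩
      rw [map_zero, R.aug_homogeneous _ hb _ (single_one_mem_freeComponent _ b)]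
  choose g hg hgR using h
  refine ⟨Finsupp.linearCombination A g, isHomogeneousMap_of_basis fun b => ?_, ?_⟩
  · simpa using hg b
  · ext b : 2
    simp [hgR]

variable (R P) in
theorem exists_chainMap :
    ∃ f : ∀ i, (R.basis i →₀ A) →ₗ[A] (P.basis i →₀ A),
      (∀ i, IsHomogeneousMap 𝒜 (R.deg i) (P.deg i) (f i)) ∧ P.aug ∘ₗ f 0 = R.aug ∧
      ∀ i, P.diff i ∘ₗ f (i + 1) = f i ∘ₗ R.diff i := by
  have lift {i : ℕ} (f : (R.basis i →₀ A) →ₗ[A] (P.basis i →₀ A))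
      (hf : IsHomogeneousMap 𝒜 (R.deg i) (P.deg i) f)
      (h : LinearMap.range (f ∘ₗ R.diff i) ≤ LinearMap.range (P.diff i)) :=
    exists_lift (f := f ∘ₗ R.diff i) (fun γ x hx => hf _ _ (R.diff_homogeneous i γ x hx)) h
  obtain ⟨f₀, hf₀, hf₀R⟩ := R.exists_lift_aug P
  obtain ⟨f₁, hf₁, hf₁R⟩ := lift f₀ hf₀ (by
    rintro _ ⟨x, rfl⟩
    refine (P.exact_zero _).1 ((LinearMap.congr_fun hf₀R (R.diff 0 x)).trans ?_)
    exact R.exact_zero.apply_apply_eq_zero x)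
  obtain ⟨f, rfl, hf⟩ := exists_dependent_sequence
    (T := fun i => (R.basis i →₀ A) →ₗ[A] (P.basis i →₀ A))
    (fun i f g => (IsHomogeneousMap 𝒜 (R.deg i) (P.deg i) f ∧
      IsHomogeneousMap 𝒜 (R.deg (i + 1)) (P.deg (i + 1)) g) ∧ P.diff i ∘ₗ g = f ∘ₗ R.diff i)
    ⟨⟨hf₀, hf₁⟩, hf₁R⟩ (by
      rintro i f g ⟨⟨-, hg⟩, hfg⟩
      obtain ⟨g', hg', hgg'⟩ := lift g hg (by
        rintro _ ⟨x, rfl⟩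
        refine (P.exact_succ i _).1 ((LinearMap.congr_fun hfg (R.diff (i + 1) x)).trans ?_)
        rw [LinearMap.comp_apply, R.diff_diff, map_zero])
      exact ⟨g', ⟨hg, hg'⟩, hgg'⟩)
  exact ⟨f, fun i => (hf i).1.1, hf₀R, fun i => (hf i).2⟩

theorem exists_homotopy (f : ∀ i, (R.basis i →₀ A) →ₗ[A] (P.basis i →₀ A))
    (hf : ∀ i, IsHomogeneousMap 𝒜 (R.deg i) (P.deg i) (f i)) (hf₀ : P.aug ∘ₗ f 0 = 0)
    (hfd : ∀ i, P.diff i ∘ₗ f (i + 1) = f i ∘ₗ R.diff i) :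
    ∃ h : ∀ i, (R.basis i →₀ A) →ₗ[A] (P.basis (i + 1) →₀ A),
      (∀ i, IsHomogeneousMap 𝒜 (R.deg i) (P.deg (i + 1)) (h i)) ∧ P.diff 0 ∘ₗ h 0 = f 0 ∧
      ∀ i, P.diff (i + 1) ∘ₗ h (i + 1) = f (i + 1) - h i ∘ₗ R.diff i := by
  have lift {i : ℕ} (h : (R.basis i →₀ A) →ₗ[A] (P.basis (i + 1) →₀ A))
      (hh : IsHomogeneousMap 𝒜 (R.deg i) (P.deg (i + 1)) h)
      (hzero : ∀ x, P.diff i (h (R.diff i x)) = f i (R.diff i x)) :=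
    exists_lift (f := f (i + 1) - h ∘ₗ R.diff i)
      (fun γ x hx => Submodule.sub_mem _ (hf _ _ _ hx) (hh _ _ (R.diff_homogeneous i γ x hx)))
      (by
        rintro _ ⟨x, rfl⟩
        refine (P.exact_succ i _).1 ?_
        rw [LinearMap.sub_apply, map_sub, LinearMap.comp_apply, hzero, sub_eq_zero]
        exact LinearMap.congr_fun (hfd i) x)
  obtain ⟨h₀, hh₀, hh₀f⟩ := exists_lift (hf 0) (by
    rintro _ ⟨x, rfl⟩
    exact (P.exact_zero _).1 (LinearMap.congr_fun hf₀ x))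
  obtain ⟨h₁, hh₁, hh₁f⟩ := lift h₀ hh₀ fun x => LinearMap.congr_fun hh₀f _
  obtain ⟨h, rfl, hh⟩ := exists_dependent_sequence
    (T := fun i => (R.basis i →₀ A) →ₗ[A] (P.basis (i + 1) →₀ A))
    (fun i h h' => (IsHomogeneousMap 𝒜 (R.deg i) (P.deg (i + 1)) h ∧
      IsHomogeneousMap 𝒜 (R.deg (i + 1)) (P.deg (i + 2)) h') ∧
      P.diff (i + 1) ∘ₗ h' = f (i + 1) - h ∘ₗ R.diff i)
    ⟨⟨hh₀, hh₁⟩, hh₁f⟩ (by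
      rintro i h h' ⟨⟨-, hh'⟩, hf'⟩
      obtain ⟨h'', hh'', hf''⟩ := lift h' hh' fun x => by
        refine (LinearMap.congr_fun hf' (R.diff (i + 1) x)).trans ?_
        rw [LinearMap.sub_apply, LinearMap.comp_apply, R.diff_diff, map_zero, sub_zero]
      exact ⟨h'', ⟨hh', hh''⟩, hf''⟩)
  exact ⟨h, fun i => (hh i).1.1, hh₀f, fun i => (hh i).2⟩

end Lifting

variable {R}

theorem cycles_le_tensorComponent (i : ℕ) (γ : Γ) : R.cycles i γ ≤ R.tensorComponent i γ := by
  cases i with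
  | zero => exact le_rfl
  | succ i => exact inf_le_left

theorem tmul_mem_boundaries_of_homotopy {φ : ∀ i, (R.basis i →₀ A) →ₗ[A] (R.basis i →₀ A)}
    {h : ∀ i, (R.basis i →₀ A) →ₗ[A] (R.basis (i + 1) →₀ A)}
    (hh : ∀ i, IsHomogeneousMap 𝒜 (R.deg i) (R.deg (i + 1)) (h i))
    (hh₀ : R.diff 0 ∘ₗ h 0 = φ 0)
    (hhd : ∀ i, R.diff (i + 1) ∘ₗ h (i + 1) = φ (i + 1) - h i ∘ₗ R.diff i)
    {i : ℕ} {γ : Γ} {x : R.basis i →₀ A} (hx : x ∈ freeComponent 𝒜 (R.deg i) γ)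
    (hc : (1 : A ⧸ 𝔪) ⊗ₜ[A] x ∈ R.cycles i γ) :
    (1 : A ⧸ 𝔪) ⊗ₜ[A] φ i x ∈ R.boundaries i γ := by
  refine ⟨(1 : A ⧸ 𝔪) ⊗ₜ[A] h i x, ⟨h i x, hh _ _ _ hx, rfl⟩, ?_⟩
  change (1 : A ⧸ 𝔪) ⊗ₜ[A] R.diff i (h i x) = _
  cases i with
  | zero => exact congrArg _ (LinearMap.congr_fun hh₀ x)
  | succ i =>
    have hdx : (1 : A ⧸ 𝔪) ⊗ₜ[A] R.diff i x = 0 := hc.2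
    have hhdx : (1 : A ⧸ 𝔪) ⊗ₜ[A] h i (R.diff i x) = 0 := by
      rw [← LinearMap.lTensor_tmul, hdx, map_zero]
    rw [← LinearMap.comp_apply, hhd, LinearMap.sub_apply, TensorProduct.tmul_sub,
      LinearMap.comp_apply, hhdx, sub_zero]

theorem finrank_tor_le [DecidableEq Γ] [GradedAlgebra 𝒜] (i : ℕ) (γ : Γ)
    [Module.Finite k (P.tensorComponent i γ)] :
    Module.Finite k (R.Tor i γ) ∧
      Module.finrank k (R.Tor i γ) ≤ Module.finrank k (P.tensorComponent i γ) := by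
  obtain ⟨f, hf, hf₀, hfd⟩ := R.exists_chainMap P
  obtain ⟨g, hg, hg₀, hgd⟩ := P.exists_chainMap R
  obtain ⟨h, hh, hh₀, hhd⟩ := exists_homotopy (R := R) (P := R)
    (fun i => g i ∘ₗ f i - LinearMap.id)
    (fun i γ x hx => Submodule.sub_mem _ (hg _ _ _ (hf _ _ _ hx)) hx)
    (by rw [LinearMap.comp_sub, ← LinearMap.comp_assoc, hg₀, hf₀, LinearMap.comp_id, sub_self])
    (fun i => by
      rw [LinearMap.comp_sub, ← LinearMap.comp_assoc, hgd, LinearMap.comp_assoc, hfd,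
        LinearMap.sub_comp, LinearMap.comp_assoc, LinearMap.comp_id, LinearMap.id_comp])
  let Φ : P.Tensored i →ₗ[k] (R.Tensored i ⧸ R.boundaries i γ) :=
    (R.boundaries i γ).mkQ ∘ₗ ((g i).lTensor (A ⧸ 𝔪)).restrictScalars k
  have hle : (R.cycles i γ).map (R.boundaries i γ).mkQ ≤ (P.tensorComponent i γ).map Φ := by
    rintro _ ⟨z, hz, rfl⟩
    obtain ⟨x, hx, rfl⟩ := cycles_le_tensorComponent i γ hz
    refine ⟨(1 : A ⧸ 𝔪) ⊗ₜ[A] f i x, ⟨f i x, hf _ _ _ hx, rfl⟩, (Submodule.Quotient.eq _).2 ?_⟩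
    have hb := tmul_mem_boundaries_of_homotopy (φ := fun i => g i ∘ₗ f i - LinearMap.id)
      hh hh₀ hhd hx hz
    rwa [LinearMap.sub_apply, TensorProduct.tmul_sub] at hb
  exact ⟨Submodule.finiteDimensional_of_le hle,
    (Submodule.finrank_mono hle).trans (Submodule.finrank_map_le _ _)⟩

end GradedFreeResolution

/-! ### Cells -/

section Cells

variable {n : ℕ}

/-- Cells are words of monomials, read from right to left: the last letter is the head. The
letters that can be appended to a cell depend on the cell. -/
def IsCell (letters : List (Fin n →₀ ℕ) → Set (Fin n →₀ ℕ)) : List (Fin n →₀ ℕ) → Prop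
  | [] => True
  | u :: c => IsCell letters c ∧ u ∈ letters c

/-- The iterated colon ideals attached to cells: `v` is in the colon ideal of `u :: c` if `u v`
lies in the monomial ideal `I` or is divisible by a letter of `c` with priority over `u`. -/
def colonSet (I : Set (Fin n →₀ ℕ)) (letters : List (Fin n →₀ ℕ) → Set (Fin n →₀ ℕ))
    (prior : List (Fin n →₀ ℕ) → (Fin n →₀ ℕ) → (Fin n →₀ ℕ) → Prop) :
    List (Fin n →₀ ℕ) → Set (Fin n →₀ ℕ)
  | [] => {w | w ≠ 0}
  | u :: c => {v | u + v ∈ I ∨ ∃ u' ∈ letters c, prior c u' u ∧ u' ≤ u + v}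

/-- A rule for appending letters, such that the letters generate the colon ideals modulo `I`. -/
structure LetterSystem (I : Set (Fin n →₀ ℕ)) where
  /-- the letters that can be appended to a cell -/
  letters : List (Fin n →₀ ℕ) → Set (Fin n →₀ ℕ)
  /-- the priority of the letters -/
  prior : List (Fin n →₀ ℕ) → (Fin n →₀ ℕ) → (Fin n →₀ ℕ) → Prop
  isStrictTotalOrder_prior : ∀ c, IsStrictTotalOrder _ (prior c)
  letters_subset : ∀ c, IsCell letters c → letters c ⊆ colonSet I letters prior c
  exists_letter_le : ∀ c, IsCell letters c → ∀ w ∈ colonSet I letters prior c, w ∉ I →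
    ∃ u ∈ letters c, u ≤ w

attribute [instance] LetterSystem.isStrictTotalOrder_prior

namespace LetterSystem

variable {I : Set (Fin n →₀ ℕ)} (L : LetterSystem I)

/-- The cells of length `i`; they index a basis of the `i`-th module of the resolution. -/
def Cell (i : ℕ) : Type := {c : List (Fin n →₀ ℕ) // IsCell L.letters c ∧ c.length = i}

/-- The colon ideal of a cell. -/
def colon (c : List (Fin n →₀ ℕ)) : Set (Fin n →₀ ℕ) := colonSet I L.letters L.prior c

/-- The empty cell. -/
def nil : L.Cell 0 := ⟨[], trivial, rfl⟩

namespace Cell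

variable {L} {i : ℕ}

theorem eq_nil (c : L.Cell 0) : c = L.nil :=
  Subtype.ext (List.length_eq_zero_iff.1 c.2.2)

theorem exists_eq_cons (c : L.Cell (i + 1)) :
    ∃ (b : L.Cell i) (u : Fin n →₀ ℕ), u ∈ L.letters b.1 ∧ c.1 = u :: b.1 :=
  match c with
  | ⟨u :: b, h, hi⟩ => ⟨⟨b, h.1, Nat.succ_injective hi⟩, u, h.2, rfl⟩

/-- The cell obtained by deleting the last letter. -/
noncomputable def parent (c : L.Cell (i + 1)) : L.Cell i := c.exists_eq_cons.choose

/-- The last letter of a cell. -/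
noncomputable def letter (c : L.Cell (i + 1)) : Fin n →₀ ℕ := c.exists_eq_cons.choose_spec.choose

theorem letter_mem (c : L.Cell (i + 1)) : c.letter ∈ L.letters c.parent.1 :=
  c.exists_eq_cons.choose_spec.choose_spec.1

theorem val_eq (c : L.Cell (i + 1)) : c.1 = c.letter :: c.parent.1 :=
  c.exists_eq_cons.choose_spec.choose_spec.2

theorem eq_of_parent_letter {c c' : L.Cell (i + 1)} (hp : c.parent = c'.parent)
    (hl : c.letter = c'.letter) : c = c' :=
  Subtype.ext (by rw [c.val_eq, c'.val_eq, hp, hl])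

/-- Appends a letter. -/
def cons (c : L.Cell i) (u : Fin n →₀ ℕ) (hu : u ∈ L.letters c.1) : L.Cell (i + 1) :=
  ⟨u :: c.1, ⟨c.2.1, hu⟩, congrArg (· + 1) c.2.2⟩

theorem letter_cons (c : L.Cell i) (u : Fin n →₀ ℕ) (hu : u ∈ L.letters c.1) :
    (c.cons u hu).letter = u :=
  (List.cons.inj (c.cons u hu).val_eq).1.symm

theorem parent_cons (c : L.Cell i) (u : Fin n →₀ ℕ) (hu : u ∈ L.letters c.1) :
    (c.cons u hu).parent = c :=
  Subtype.ext (List.cons.inj (c.cons u hu).val_eq).2.symm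

theorem mem_colon (c : L.Cell (i + 1)) (v : Fin n →₀ ℕ) :
    v ∈ L.colon c.1 ↔ c.letter + v ∈ I ∨
      ∃ u ∈ L.letters c.parent.1, L.prior c.parent.1 u c.letter ∧ u ≤ c.letter + v := by
  rw [colon, c.val_eq]
  rfl

theorem letter_mem_colon (c : L.Cell (i + 1)) : c.letter ∈ L.colon c.parent.1 :=
  L.letters_subset _ c.parent.2.1 c.letter_mem

theorem exists_factor (c : L.Cell i) {w : Fin n →₀ ℕ} (hw : w ∈ L.colon c.1) (hI : w ∉ I) :
    ∃ (c' : L.Cell (i + 1)) (v : Fin n →₀ ℕ), c'.parent = c ∧ c'.letter + v = w ∧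
      v ∉ L.colon c'.1 := by
  obtain ⟨u₀, hu₀, hle₀⟩ := L.exists_letter_le c.1 c.2.1 w hw hI
  have hfin : {u | u ∈ L.letters c.1 ∧ u ≤ w}.Finite :=
    (Set.finite_Iic w).subset fun u hu => hu.2
  obtain ⟨⟨u, hu, hle⟩, -, hmin⟩ :=
    (hfin.wellFoundedOn (r := L.prior c.1)).has_min Set.univ ⟨⟨u₀, hu₀, hle₀⟩, trivial⟩
  obtain ⟨v, rfl⟩ := exists_add_of_le hle
  refine ⟨c.cons u hu, v, c.parent_cons u hu, by rw [letter_cons], fun hv => ?_⟩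
  rw [mem_colon, letter_cons, parent_cons] at hv
  rcases hv with h | ⟨u', hu', hprior, hle'⟩
  exacts [hI h, hmin ⟨u', hu', hle'⟩ trivial hprior]

theorem not_prior_of_notMem_colon {c c' : L.Cell (i + 1)} {v v' : Fin n →₀ ℕ}
    (hp : c.parent = c'.parent) (he : c.letter + v = c'.letter + v')
    (hv' : v' ∉ L.colon c'.1) : ¬ L.prior c.parent.1 c.letter c'.letter := fun h =>
  hv' ((mem_colon c' v').2 (Or.inr ⟨c.letter, hp ▸ c.letter_mem, hp ▸ h, he ▸ le_self_add⟩))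

theorem factor_unique {c c' : L.Cell (i + 1)} {v v' : Fin n →₀ ℕ}
    (hp : c.parent = c'.parent) (he : c.letter + v = c'.letter + v') (hv : v ∉ L.colon c.1)
    (hv' : v' ∉ L.colon c'.1) : c = c' ∧ v = v' := by
  have hl : c.letter = c'.letter := Std.Trichotomous.trichotomous (r := L.prior c.parent.1) _ _
    (not_prior_of_notMem_colon hp he hv') (hp ▸ not_prior_of_notMem_colon hp.symm he.symm hv)
  exact ⟨eq_of_parent_letter hp hl, add_left_cancel (hl ▸ he)⟩

end Cell

/-- The lexicographic order on cells given by the priorities of the letters. -/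
def cellLT : List (Fin n →₀ ℕ) → List (Fin n →₀ ℕ) → Prop
  | u :: c, u' :: c' => cellLT c c' ∨ c = c' ∧ L.prior c u u'
  | _, _ => False

variable {L} {i : ℕ}

theorem cellLT_trans : ∀ {x y z : List (Fin n →₀ ℕ)},
    L.cellLT x y → L.cellLT y z → L.cellLT x z
  | _ :: _, _ :: _, _ :: _, .inl hxy, .inl hyz => Or.inl (cellLT_trans hxy hyz)
  | _ :: _, _ :: _, _ :: _, .inl hxy, .inr ⟨hyz, _⟩ => Or.inl (hyz ▸ hxy)
  | _ :: _, _ :: _, _ :: _, .inr ⟨hxy, _⟩, .inl hyz => Or.inl (hxy ▸ hyz)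
  | _ :: _, _ :: _, _ :: _, .inr ⟨hxy, hu⟩, .inr ⟨hyz, hv⟩ =>
    Or.inr ⟨hxy.trans hyz, _root_.trans hu (hxy ▸ hv)⟩

theorem cellLT_irrefl : ∀ x : List (Fin n →₀ ℕ), ¬ L.cellLT x x
  | _ :: x, .inl h => cellLT_irrefl x h
  | u :: x, .inr ⟨_, h⟩ => irrefl_of (L.prior x) u h

variable (L) in
/-- A monomial in the free module with basis the cells of length `i`. -/
abbrev Pair (i : ℕ) : Type := L.Cell i × (Fin n →₀ ℕ)

namespace Pair

/-- The total degree of a monomial in the free module. -/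
noncomputable def total (p : L.Pair i) : Fin n →₀ ℕ := p.1.1.sum + p.2

/-- The leading monomial of the image of a monomial under the differential. -/
noncomputable def lead (p : L.Pair (i + 1)) : L.Pair i := (p.1.parent, p.1.letter + p.2)

theorem total_lead (p : L.Pair (i + 1)) : p.lead.total = p.total := by
  rw [total, total, lead, p.1.val_eq, List.sum_cons, add_assoc, add_left_comm]

variable {Γ : Type w} [AddCommMonoid Γ] (d : Fin n → Γ)

/-- The (partial) order on the monomials of the free module. Only monomials of the same weight are
comparable. -/
def Below (p q : L.Pair i) : Prop :=
  Finsupp.weight d p.total = Finsupp.weight d q.total ∧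
    (p.total ≺[MonomialOrder.degLex] q.total ∨ p.total = q.total ∧ L.cellLT p.1.1 q.1.1)

variable {d}

theorem Below.trans {p q r : L.Pair i} (hpq : p.Below d q) (hqr : q.Below d r) :
    p.Below d r := by
  refine ⟨hpq.1.trans hqr.1, ?_⟩
  rcases hpq.2 with hpq | ⟨epq, hpq⟩ <;> rcases hqr.2 with hqr | ⟨eqr, hqr⟩
  · exact Or.inl (hpq.trans hqr)
  · exact Or.inl (eqr ▸ hpq)
  · exact Or.inl (epq ▸ hqr)
  · exact Or.inr ⟨epq.trans eqr, cellLT_trans hpq hqr⟩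

theorem Below.irrefl (p : L.Pair i) : ¬ p.Below d p := by
  rintro ⟨-, h | ⟨-, h⟩⟩
  exacts [lt_irrefl _ h, cellLT_irrefl _ h]

theorem Below.add {p q : L.Pair i} (h : p.Below d q) (v : Fin n →₀ ℕ) :
    Below d (p.1, p.2 + v) (q.1, q.2 + v) := by
  have htotal (r : L.Pair i) : total (r.1, r.2 + v) = r.total + v := (add_assoc _ _ _).symm
  simp only [Below, htotal, map_add, h.1, true_and]
  refine h.2.imp (fun h => by gcongr) fun h => ⟨by rw [h.1], h.2⟩

theorem below_of_lead {p q : L.Pair (i + 1)} (h : p.lead.Below d q.lead) : p.Below d q := by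
  simp only [Below, total_lead] at h
  refine h.imp_right (Or.imp_right (And.imp_right fun h => ?_))
  rw [p.1.val_eq, q.1.val_eq]
  exact Or.inl h

theorem below_of_lt {c : L.Cell i} {v w : Fin n →₀ ℕ} (h : v ≺[MonomialOrder.degLex] w)
    (h' : Finsupp.weight d v = Finsupp.weight d w) : Below d (c, v) (c, w) := by
  simp only [Below, total, map_add, h', true_and]
  exact Or.inl (by gcongr)

variable (d) in
theorem wellFounded_below [Finite (L.Cell i)] :
    WellFounded (Below d : L.Pair i → L.Pair i → Prop) := by
  have hcell : WellFounded fun c c' : L.Cell i => L.cellLT c.1 c'.1 := by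
    have : IsTrans (L.Cell i) fun c c' => L.cellLT c.1 c'.1 := ⟨fun _ _ _ => cellLT_trans⟩
    have : Std.Irrefl fun c c' : L.Cell i => L.cellLT c.1 c'.1 := ⟨fun _ => cellLT_irrefl _⟩
    exact Finite.wellFounded_of_trans_of_irrefl _
  have hlex := (wellFounded_lt (α := (MonomialOrder.degLex (σ := Fin n)).syn)).prod_lex hcell
  refine Subrelation.wf (fun {p q} h => Prod.lex_def.2 (h.2.imp_right (And.imp_left ?_)))
    (InvImage.wf (fun p : L.Pair i => (MonomialOrder.degLex.toSyn p.total, p.1)) hlex)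
  exact congrArg MonomialOrder.degLex.toSyn

end Pair

end LetterSystem

end Cells

/-! ### The resolution attached to a letter system -/

theorem one_tmul_single_of_mk_eq {k : Type u} [Field k] {A : Type u} [CommRing A] [Algebra k A]
    {𝔪 : Ideal A} {ι : Type v} (b : ι) {r : A} {t : k}
    (h : Ideal.Quotient.mk 𝔪 r = t • (1 : A ⧸ 𝔪)) :
    (1 : A ⧸ 𝔪) ⊗ₜ[A] Finsupp.single b r =
      t • ((1 : A ⧸ 𝔪) ⊗ₜ[A] Finsupp.single b (1 : A)) := by
  have hsingle : Finsupp.single b r = r • Finsupp.single b (1 : A) := by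
    rw [Finsupp.smul_single, smul_eq_mul, mul_one]
  have hsmul : r • (1 : A ⧸ 𝔪) = t • 1 := by
    rw [← h, Algebra.smul_def, mul_one]
    rfl
  rw [hsingle, TensorProduct.tmul_smul, TensorProduct.smul_tmul', hsmul,
    ← TensorProduct.smul_tmul']

namespace LetterSystem

variable {k : Type u} [Field k] {n : ℕ} {Γ : Type w} [AddCommMonoid Γ]
  {a : Ideal (MvPolynomial (Fin n) k)} {d : Fin n → Γ}
  {L : LetterSystem (initialMonomials a)} {i : ℕ}

/-- The free module over `S ⧸ a` with basis the cells of length `i`. -/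
abbrev CellModule (L : LetterSystem (initialMonomials a)) (i : ℕ) : Type u :=
  L.Cell i →₀ (MvPolynomial (Fin n) k ⧸ a)

section MonomialSpan

/-- A monomial as an element of the free module. -/
noncomputable def Pair.elem (p : L.Pair i) : L.CellModule i :=
  Finsupp.single p.1 (residueMonomial a p.2)

theorem Pair.smul_elem (p : L.Pair i) (v : Fin n →₀ ℕ) :
    residueMonomial a v • p.elem = Pair.elem (p.1, p.2 + v) := by
  rw [elem, elem, Finsupp.smul_single, smul_eq_mul, mul_comm, residueMonomial_add]

/-- The `k`-span of a set of monomials of the free module. -/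
noncomputable def monomialSpan (T : Set (L.Pair i)) : Submodule k (L.CellModule i) :=
  Submodule.span k (Pair.elem '' T)

theorem elem_mem_monomialSpan {T : Set (L.Pair i)} {p : L.Pair i} (h : p ∈ T) :
    p.elem ∈ monomialSpan T :=
  Submodule.subset_span ⟨p, h, rfl⟩

theorem monomialSpan_le {T : Set (L.Pair i)} {N : Submodule k (L.CellModule i)}
    (h : ∀ p ∈ T, p.elem ∈ N) : monomialSpan T ≤ N :=
  Submodule.span_le.2 (Set.image_subset_iff.2 h)

theorem monomialSpan_univ : monomialSpan (Set.univ : Set (L.Pair i)) = ⊤ := by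
  rw [eq_top_iff, ← Finsupp.iSup_lsingle_range, iSup_le_iff]
  intro c
  rw [← Submodule.map_top, ← span_range_residueMonomial, Submodule.map_span, Submodule.span_le]
  rintro _ ⟨_, ⟨v, rfl⟩, rfl⟩
  exact elem_mem_monomialSpan (p := (c, v)) trivial

theorem smul_mem_monomialSpan {T T' : Set (L.Pair i)} (v : Fin n →₀ ℕ)
    (h : ∀ p ∈ T, (p.1, p.2 + v) ∈ T') {x : L.CellModule i} (hx : x ∈ monomialSpan T) :
    residueMonomial a v • x ∈ monomialSpan T' := by
  suffices monomialSpan T ≤ (monomialSpan T').comap (Algebra.lsmul k k _ (residueMonomial a v)) from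
    this hx
  refine monomialSpan_le fun p hp => ?_
  rw [Submodule.mem_comap, Algebra.lsmul_apply, Pair.smul_elem]
  exact elem_mem_monomialSpan (h p hp)

variable (d) in
/-- The span of the monomials below a given one. -/
noncomputable abbrev low (p : L.Pair i) : Submodule k (L.CellModule i) :=
  monomialSpan {q | q.Below d p}

theorem elem_mem_low_of_reducible (hd : IsHomogeneousFor d a) {p : L.Pair i}
    (hp : p.2 ∈ initialMonomials a) : p.elem ∈ low d p := by
  have h := Submodule.mem_map_of_mem (f := Finsupp.lsingle (R := k) p.1)
    (residueMonomial_mem_span_lt hd hp)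
  rw [Submodule.map_span] at h
  refine Submodule.span_le.2 ?_ h
  rintro _ ⟨_, ⟨v, ⟨hv, hv'⟩, rfl⟩, rfl⟩
  exact elem_mem_monomialSpan (p := (p.1, v)) (Pair.below_of_lt hv hv')

variable (L i) in
/-- The monomials of the free module that are normal with respect to the colon ideals. Their span
is a complement of the cycles. -/
def normalPairs : Set (L.Pair i) := {p | p.2 ∉ L.colon p.1.1}

end MonomialSpan

/-! ### Leading coefficients -/

section Coefficients

/-- The coefficient of an irreducible monomial. -/
noncomputable def coeffPair (p : L.Pair i) (hp : p.2 ∉ initialMonomials a) :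
    L.CellModule i →ₗ[k] k :=
  (irreducibleBasis a).coord ⟨p.2, hp⟩ ∘ₗ Finsupp.lapply p.1

theorem coeffPair_self (p : L.Pair i) (hp : p.2 ∉ initialMonomials a) :
    coeffPair p hp p.elem = 1 := by
  rw [coeffPair, LinearMap.comp_apply, Pair.elem, Finsupp.lapply_apply, Finsupp.single_eq_same]
  exact coord_residueMonomial_self ⟨p.2, hp⟩

theorem eq_or_below_of_coeffPair_ne_zero (hd : IsHomogeneousFor d a) {p : L.Pair i}
    (hp : p.2 ∉ initialMonomials a) {q : L.Pair i} (h : coeffPair p hp q.elem ≠ 0) :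
    p = q ∨ p.Below d q := by
  obtain ⟨c, v⟩ := p
  obtain ⟨c', v'⟩ := q
  rw [coeffPair, LinearMap.comp_apply, Pair.elem, Finsupp.lapply_apply] at h
  obtain rfl : c = c' := by
    by_contra hc
    rw [Finsupp.single_eq_of_ne hc, map_zero] at h
    exact h rfl
  rw [Finsupp.single_eq_same] at h
  exact (eq_or_lt_of_coord_ne_zero hd ⟨v, hp⟩ v' h).imp (congrArg (Prod.mk c))
    fun h => Pair.below_of_lt h.1 h.2

theorem coeffPair_eq_zero_of_mem_low (hd : IsHomogeneousFor d a) {p : L.Pair i}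
    (hp : p.2 ∉ initialMonomials a) {q : L.Pair i} (hpq : ¬ p.Below d q)
    {x : L.CellModule i} (hx : x ∈ low d q) : coeffPair p hp x = 0 := by
  refine LinearMap.mem_ker.1 ((monomialSpan_le fun r (hr : r.Below d q) => ?_ :
    low d q ≤ LinearMap.ker (coeffPair p hp)) hx)
  by_contra h
  rcases eq_or_below_of_coeffPair_ne_zero hd hp h with rfl | h
  exacts [hpq hr, hpq (h.trans hr)]

end Coefficients

/-! ### Maps with prescribed leading terms -/

section Leading

variable (d) in
/-- A map between the free modules on the cells sending each basis element to an element with the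
prescribed leading term. -/
def IsLeading (D : L.CellModule (i + 1) →ₗ[MvPolynomial (Fin n) k ⧸ a] L.CellModule i) : Prop :=
  ∀ c : L.Cell (i + 1),
    D (Finsupp.single c 1) - (Pair.lead (c, 0)).elem ∈ low d (Pair.lead (c, 0))

variable {D : L.CellModule (i + 1) →ₗ[MvPolynomial (Fin n) k ⧸ a] L.CellModule i}

theorem IsLeading.map_elem_sub_mem_low (hD : IsLeading d D) (p : L.Pair (i + 1)) :
    D p.elem - p.lead.elem ∈ low d p.lead := by
  obtain ⟨c, v⟩ := p
  have helem : (Pair.elem (c, v) : L.CellModule (i + 1)) =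
      residueMonomial a v • Finsupp.single c 1 := by
    rw [Pair.elem, Finsupp.smul_single, smul_eq_mul, mul_one]
  have hlead : Pair.lead (c, v) = (c.parent, (Pair.lead (c, 0)).2 + v) := by
    simp only [Pair.lead, add_zero]
  have hlead' : (Pair.lead (c, v)).elem = residueMonomial a v • (Pair.lead (c, 0)).elem := by
    rw [Pair.smul_elem, hlead]
    rfl
  rw [helem, hlead', map_smul, ← smul_sub]
  refine smul_mem_monomialSpan v (fun p hp => ?_) (hD c)
  rw [hlead]
  exact Pair.Below.add hp v

theorem IsLeading.coeffPair_map_elem_self (hd : IsHomogeneousFor d a) (hD : IsLeading d D)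
    {p : L.Pair (i + 1)} (hp : p.lead.2 ∉ initialMonomials a) :
    coeffPair p.lead hp (D p.elem) = 1 := by
  have h := coeffPair_eq_zero_of_mem_low hd hp (Pair.Below.irrefl _) (hD.map_elem_sub_mem_low p)
  rwa [map_sub, coeffPair_self, sub_eq_zero] at h

theorem IsLeading.coeffPair_map_elem_eq_zero (hd : IsHomogeneousFor d a) (hD : IsLeading d D)
    {p q : L.Pair (i + 1)} (hp : p.lead.2 ∉ initialMonomials a) (hne : p.lead ≠ q.lead)
    (hpq : ¬ p.lead.Below d q.lead) : coeffPair p.lead hp (D q.elem) = 0 := by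
  have h := coeffPair_eq_zero_of_mem_low hd hp hpq (hD.map_elem_sub_mem_low q)
  have hlead : coeffPair p.lead hp q.lead.elem = 0 := by
    by_contra h
    exact (eq_or_below_of_coeffPair_ne_zero hd hp h).elim hne hpq
  rwa [map_sub, hlead, sub_zero] at h

theorem lead_injOn_normalPairs : Set.InjOn Pair.lead (L.normalPairs (i + 1)) := by
  intro p hp q hq h
  obtain ⟨hparent, hmonomial⟩ := Prod.mk.inj h
  obtain ⟨hcell, hv⟩ := Cell.factor_unique hparent hmonomial hp hq
  exact Prod.ext hcell hv

theorem lead_notMem_initialMonomials {p : L.Pair (i + 1)} (hp : p ∈ L.normalPairs (i + 1)) :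
    p.lead.2 ∉ initialMonomials a := fun h =>
  hp ((Cell.mem_colon _ _).2 (Or.inl h))

theorem exists_maximal_lead {s : Finset (L.Pair (i + 1))} (hs : s.Nonempty) :
    ∃ q ∈ s, ∀ p ∈ s, ¬ q.lead.Below d p.lead := by
  have : IsStrictOrder (L.Pair (i + 1)) fun p q => q.lead.Below d p.lead :=
    { irrefl := fun p => Pair.Below.irrefl _
      trans := fun _ _ _ hqp hrq => hrq.trans hqp }
  obtain ⟨q₀, hq₀⟩ := hs
  obtain ⟨⟨q, hq⟩, -, hmax⟩ := (s.finite_toSet.wellFoundedOn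
    (r := fun p q : L.Pair (i + 1) => q.lead.Below d p.lead)).has_min Set.univ ⟨⟨q₀, hq₀⟩, trivial⟩
  exact ⟨q, hq, fun p hp => hmax ⟨p, hp⟩ trivial⟩

theorem IsLeading.eq_zero_of_map_eq_zero (hd : IsHomogeneousFor d a) (hD : IsLeading d D)
    {x : L.CellModule (i + 1)} (hx : x ∈ monomialSpan (L.normalPairs (i + 1))) (h₀ : D x = 0) :
    x = 0 := by
  rw [monomialSpan, Finsupp.mem_span_image_iff_linearCombination] at hx
  obtain ⟨l, hl, rfl⟩ := hx
  by_contra hne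
  have hsupp : l.support.Nonempty := Finsupp.support_nonempty_iff.2 fun h =>
    hne (by rw [h, map_zero])
  obtain ⟨q, hq, hmax⟩ := exists_maximal_lead (d := d) hsupp
  have hqI := lead_notMem_initialMonomials (hl hq)
  have hcoeff : coeffPair q.lead hqI (D (Finsupp.linearCombination k Pair.elem l)) = l q := by
    rw [Finsupp.linearCombination_apply, Finsupp.sum, map_sum, map_sum,
      Finset.sum_eq_single_of_mem q hq]
    · rw [LinearMap.map_smul_of_tower, map_smul, hD.coeffPair_map_elem_self hd, smul_eq_mul,
        mul_one]
    · intro p hp hpq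
      rw [LinearMap.map_smul_of_tower, map_smul, hD.coeffPair_map_elem_eq_zero hd hqI
        (fun h => hpq (lead_injOn_normalPairs (hl hp) (hl hq) h.symm)) (hmax p hp), smul_zero]
  rw [h₀, map_zero] at hcoeff
  exact Finsupp.mem_support_iff.1 hq hcoeff.symm

section Finite

variable [Finite (L.Cell i)]

theorem IsLeading.monomialSpan_le_sup (hd : IsHomogeneousFor d a) (hD : IsLeading d D)
    {T : Set (L.Pair i)} (hT : ∀ p q, q ∈ T → p.Below d q → p ∈ T) :
    monomialSpan T ≤ (monomialSpan (Pair.lead ⁻¹' T)).map (D.restrictScalars k) ⊔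
      monomialSpan (L.normalPairs i) := by
  refine monomialSpan_le fun p hp => ?_
  induction p using (Pair.wellFounded_below (L := L) (i := i) d).induction with
  | _ p ih =>
  set N := (monomialSpan (Pair.lead ⁻¹' T)).map (D.restrictScalars k) ⊔
    monomialSpan (L.normalPairs i)
  have hlow : low d p ≤ N := monomialSpan_le fun q hq => ih q hq (hT q p hp hq)
  by_cases hI : p.2 ∈ initialMonomials a
  · exact hlow (elem_mem_low_of_reducible hd hI)
  by_cases hc : p.2 ∈ L.colon p.1.1
  · obtain ⟨c, v, hparent, hmonomial, -⟩ := p.1.exists_factor hc hI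
    have hlead : Pair.lead (c, v) = p := Prod.ext hparent hmonomial
    have hmap : D (Pair.elem (c, v)) ∈ N := Submodule.mem_sup_left
      (Submodule.mem_map_of_mem (f := D.restrictScalars k)
        (elem_mem_monomialSpan (Set.mem_preimage.2 (hlead.symm ▸ hp))))
    have hsub := hD.map_elem_sub_mem_low (c, v)
    rw [hlead] at hsub
    simpa only [sub_sub_cancel] using Submodule.sub_mem _ hmap (hlow hsub)
  · exact Submodule.mem_sup_right (elem_mem_monomialSpan hc)

theorem IsLeading.exists_preimage {Q : Type*} [AddCommGroup Q] [Module k Q]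
    (hd : IsHomogeneousFor d a) (hD : IsLeading d D) {f : L.CellModule i →ₗ[k] Q}
    (hf : ∀ x ∈ monomialSpan (L.normalPairs i), f x = 0 → x = 0)
    (hfD : ∀ x, f (D x) = 0) {T : Set (L.Pair i)} (hT : ∀ p q, q ∈ T → p.Below d q → p ∈ T)
    {y : L.CellModule i} (hy : y ∈ monomialSpan T) (hy₀ : f y = 0) :
    ∃ x ∈ monomialSpan (Pair.lead ⁻¹' T), D x = y := by
  obtain ⟨_, ⟨x, hx, rfl⟩, z, hz, rfl⟩ := Submodule.mem_sup.1 (hD.monomialSpan_le_sup hd hT hy)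
  rw [LinearMap.restrictScalars_apply, map_add, hfD, zero_add] at hy₀
  exact ⟨x, hx, by rw [hf z hz hy₀, add_zero, LinearMap.restrictScalars_apply]⟩

theorem IsLeading.exact {Q : Type*} [AddCommGroup Q] [Module k Q]
    (hd : IsHomogeneousFor d a) (hD : IsLeading d D) {f : L.CellModule i →ₗ[k] Q}
    (hf : ∀ x ∈ monomialSpan (L.normalPairs i), f x = 0 → x = 0)
    (hfD : ∀ x, f (D x) = 0) : Function.Exact D f := by
  refine fun y => ⟨fun hy => ?_, fun ⟨x, hx⟩ => hx ▸ hfD x⟩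
  obtain ⟨x, -, hx⟩ := hD.exists_preimage hd hf hfD (T := Set.univ) (fun _ _ _ _ => trivial)
    (by rw [monomialSpan_univ]; trivial) hy
  exact ⟨x, hx⟩

end Finite

variable (d) in
/-- Strictness with respect to the filtrations by leading monomials: an element of the image that
lies below `p` is the image of an element whose leading monomials map below `p`. -/
def IsStrict (D : L.CellModule (i + 1) →ₗ[MvPolynomial (Fin n) k ⧸ a] L.CellModule i) : Prop :=
  ∀ p x, D x ∈ low d p → ∃ y ∈ monomialSpan {q | q.lead.Below d p}, D y = D x

theorem IsLeading.isStrict {Q : Type*} [AddCommGroup Q] [Module k Q] [Finite (L.Cell i)]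
    (hd : IsHomogeneousFor d a) (hD : IsLeading d D) {f : L.CellModule i →ₗ[k] Q}
    (hf : ∀ x ∈ monomialSpan (L.normalPairs i), f x = 0 → x = 0)
    (hfD : ∀ x, f (D x) = 0) : IsStrict d D := fun p x hx =>
  hD.exists_preimage hd hf hfD (T := {q | q.Below d p})
    (fun _ _ hq hpq => Pair.Below.trans hpq hq) hx (hfD x)

theorem lead_snd_mem_colon (c : L.Cell (i + 2)) :
    (Pair.lead (c, 0)).2 ∈ L.colon (Pair.lead (c, 0)).1.1 := by
  simpa only [Pair.lead, add_zero] using c.letter_mem_colon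

theorem exists_below_lead_eq {p : L.Pair (i + 1)} {u : Fin n →₀ ℕ}
    (hu : u ∈ L.letters p.1.parent.1) (hprior : L.prior p.1.parent.1 u p.1.letter)
    (hle : u ≤ p.1.letter + p.2) : ∃ q : L.Pair (i + 1), q.Below d p ∧ q.lead = p.lead := by
  obtain ⟨v, hv⟩ := exists_add_of_le hle
  have hlead : Pair.lead (p.1.parent.cons u hu, v) = p.lead := by
    rw [Pair.lead, Cell.parent_cons, Cell.letter_cons, ← hv, Pair.lead]
  have htotal := congrArg Pair.total hlead
  rw [Pair.total_lead, Pair.total_lead] at htotal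
  refine ⟨(p.1.parent.cons u hu, v), ⟨by rw [htotal], Or.inr ⟨htotal, ?_⟩⟩, hlead⟩
  rw [p.1.val_eq]
  exact Or.inr ⟨rfl, hprior⟩

/-- If the leading monomial of `D p` is reducible then `p` itself will do; otherwise it is also the
leading monomial of `D q` for some `q` below `p`, and the leading terms cancel in `p - q`. -/
theorem IsLeading.exists_map_mem_low (hd : IsHomogeneousFor d a) (hD : IsLeading d D)
    {p : L.Pair (i + 1)} (hp : p.2 ∈ L.colon p.1.1) :
    ∃ y, y - p.elem ∈ low d p ∧ D y ∈ low d p.lead := by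
  have hDp := hD.map_elem_sub_mem_low p
  rcases (Cell.mem_colon _ _).1 hp with hI | ⟨u, hu, hprior, hle⟩
  · refine ⟨p.elem, by rw [sub_self]; exact Submodule.zero_mem _, ?_⟩
    simpa only [sub_add_cancel] using
      Submodule.add_mem _ hDp (elem_mem_low_of_reducible (p := p.lead) hd hI)
  · obtain ⟨q, hqp, hlead⟩ := exists_below_lead_eq (d := d) hu hprior hle
    have hDq := hD.map_elem_sub_mem_low q
    rw [hlead] at hDq
    refine ⟨p.elem - q.elem, ?_, ?_⟩
    · rw [sub_sub_cancel_left]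
      exact Submodule.neg_mem _ (elem_mem_monomialSpan hqp)
    · simpa only [sub_sub_sub_cancel_right, ← map_sub] using Submodule.sub_mem _ hDp hDq

theorem IsLeading.exists_cycle (hd : IsHomogeneousFor d a) (hD : IsLeading d D)
    (hDs : IsStrict d D) (c : L.Cell (i + 2)) :
    ∃ y, y - (Pair.lead (c, 0)).elem ∈ low d (Pair.lead (c, 0)) ∧ D y = 0 := by
  obtain ⟨y, hy, hDy⟩ := hD.exists_map_mem_low hd (lead_snd_mem_colon c)
  obtain ⟨z, hz, hDz⟩ := hDs _ y hDy
  refine ⟨y - z, ?_, by rw [map_sub, hDz, sub_self]⟩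
  rw [sub_right_comm]
  exact Submodule.sub_mem _ hy ((monomialSpan_le fun q hq =>
    elem_mem_monomialSpan (Pair.below_of_lead hq)) hz)

theorem IsLeading.exists_next (hd : IsHomogeneousFor d a) (hD : IsLeading d D)
    (hDs : IsStrict d D) :
    ∃ D' : L.CellModule (i + 2) →ₗ[MvPolynomial (Fin n) k ⧸ a] L.CellModule (i + 1),
      IsLeading d D' ∧ ∀ x, D (D' x) = 0 := by
  choose y hy hDy using hD.exists_cycle hd hDs
  refine ⟨Finsupp.linearCombination _ y, fun c => ?_, fun x => ?_⟩
  · rw [Finsupp.linearCombination_single, one_smul]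
    exact hy c
  · rw [Finsupp.linearCombination_apply, map_finsuppSum]
    exact Finset.sum_eq_zero fun c _ => by simp only [map_smul, hDy, smul_zero]

end Leading

/-! ### The cell resolution -/

section Augmentation

/-- The first differential of the resolution. -/
noncomputable def firstDiff (L : LetterSystem (initialMonomials a)) :
    L.CellModule 1 →ₗ[MvPolynomial (Fin n) k ⧸ a] L.CellModule 0 :=
  Finsupp.linearCombination _ fun c => (Pair.lead (c, 0)).elem

theorem firstDiff_single (c : L.Cell 1) :
    firstDiff L (Finsupp.single c 1) = (Pair.lead (c, 0)).elem := by
  rw [firstDiff, Finsupp.linearCombination_single, one_smul]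

theorem isLeading_firstDiff : IsLeading d (firstDiff L) := fun c => by
  rw [firstDiff_single, sub_self]
  exact Submodule.zero_mem _

/-- The augmentation of the resolution. -/
noncomputable def augmentation (L : LetterSystem (initialMonomials a)) :
    L.CellModule 0 →ₗ[MvPolynomial (Fin n) k ⧸ a] (MvPolynomial (Fin n) k ⧸ a) ⧸ augIdeal a :=
  Finsupp.linearCombination _ fun _ => 1

theorem augmentation_single (c : L.Cell 0) (r : MvPolynomial (Fin n) k ⧸ a) :
    augmentation L (Finsupp.single c r) = Ideal.Quotient.mk (augIdeal a) r := by
  rw [augmentation, Finsupp.linearCombination_single, ← map_one (Ideal.Quotient.mk (augIdeal a))]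
  change Ideal.Quotient.mk (augIdeal a) (r * 1) = _
  rw [mul_one]

theorem augmentation_surjective : Function.Surjective (augmentation L) := fun y => by
  obtain ⟨r, rfl⟩ := Ideal.Quotient.mk_surjective y
  exact ⟨Finsupp.single L.nil r, augmentation_single _ _⟩

theorem residueMonomial_mem_augIdeal {w : Fin n →₀ ℕ} (hw : w ≠ 0) :
    residueMonomial a w ∈ augIdeal a := by
  obtain ⟨j, hj⟩ := Finsupp.ne_iff.1 hw
  obtain ⟨v, rfl⟩ := exists_add_of_le (Finsupp.single_le_iff.2 (Nat.one_le_iff_ne_zero.2 hj))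
  rw [residueMonomial_add]
  exact Ideal.mul_mem_right _ _ (Ideal.mem_map_of_mem _ (Ideal.subset_span ⟨j, rfl⟩))

theorem augIdeal_ne_top (ha : a ≤ idealOfVars (Fin n) k) : augIdeal a ≠ ⊤ := by
  have hvars : idealOfVars (Fin n) k ≤ RingHom.ker (constantCoeff (σ := Fin n) (R := k)) := by
    refine Ideal.span_le.2 ?_
    rintro _ ⟨i, rfl⟩
    exact constantCoeff_X k i
  let ε : MvPolynomial (Fin n) k ⧸ a →+* k :=
    Ideal.Quotient.lift a constantCoeff fun f hf => hvars (ha hf)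
  exact ne_top_of_le_ne_top (RingHom.ker_ne_top ε) (Ideal.map_le_iff_le_comap.2 hvars)

theorem augmentation_firstDiff (x) : augmentation L (firstDiff L x) = 0 := by
  suffices h : augmentation L ∘ₗ firstDiff L = 0 from LinearMap.congr_fun h x
  ext c : 2
  have hletter : c.letter ≠ 0 := by
    have h := c.letter_mem_colon
    rwa [c.parent.eq_nil] at h
  simp only [LinearMap.comp_apply, Finsupp.lsingle_apply, LinearMap.zero_apply, firstDiff_single,
    Pair.elem, augmentation_single, Pair.lead, add_zero]
  exact Ideal.Quotient.eq_zero_iff_mem.2 (residueMonomial_mem_augIdeal hletter)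

theorem eq_zero_of_augmentation_eq_zero (ha : a ≤ idealOfVars (Fin n) k) {x : L.CellModule 0}
    (hx : x ∈ monomialSpan (L.normalPairs 0)) (h₀ : augmentation L x = 0) : x = 0 := by
  have hle : monomialSpan (L.normalPairs 0) ≤ Submodule.span k {Finsupp.single L.nil 1} := by
    refine monomialSpan_le fun p hp => ?_
    have hp₂ : p.2 = 0 := by
      by_contra h
      exact hp (p.1.eq_nil ▸ h)
    rw [Pair.elem, hp₂, residueMonomial_zero, p.1.eq_nil]
    exact Submodule.mem_span_singleton_self _
  obtain ⟨t, rfl⟩ := Submodule.mem_span_singleton.1 (hle hx)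
  rw [LinearMap.map_smul_of_tower, augmentation_single, map_one] at h₀
  have ht : t = 0 := by
    by_contra ht
    exact Ideal.Quotient.zero_ne_one_iff.2 (augIdeal_ne_top ha)
      ((smul_eq_zero_iff_eq (Units.mk0 t ht)).1 h₀).symm
  rw [ht, zero_smul]

theorem mk_mk_eq_coeff_smul (f : MvPolynomial (Fin n) k) :
    Ideal.Quotient.mk (augIdeal a) (Ideal.Quotient.mk a f) =
      coeff 0 f • (1 : (MvPolynomial (Fin n) k ⧸ a) ⧸ augIdeal a) := by
  rw [mk_eq_sum_residueMonomial, ← Ideal.Quotient.mkₐ_eq_mk k, map_sum, Finset.sum_eq_single 0]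
  · rw [map_smul, residueMonomial_zero, map_one]
  · intro v _ hv
    rw [map_smul, Ideal.Quotient.mkₐ_eq_mk,
      Ideal.Quotient.eq_zero_iff_mem.2 (residueMonomial_mem_augIdeal hv), smul_zero]
  · intro h
    rw [notMem_support_iff.1 h, zero_smul, map_zero]

end Augmentation

section Homogeneity

variable (L d) in
/-- The degree of a cell, as a basis element of the resolution. -/
noncomputable def cellDegree (i : ℕ) (c : L.Cell i) : Γ := Finsupp.weight d c.1.sum

theorem elem_mem_freeComponent (p : L.Pair i) :
    p.elem ∈ freeComponent (algComponent d a) (L.cellDegree d i) (Finsupp.weight d p.total) := by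
  have h := single_mem_freeComponent (L.cellDegree d i) p.1
    (residueMonomial_mem_algComponent (a := a) d p.2)
  rwa [cellDegree, ← map_add, add_comm] at h

theorem IsLeading.isHomogeneousMap
    {D : L.CellModule (i + 1) →ₗ[MvPolynomial (Fin n) k ⧸ a] L.CellModule i}
    (hD : IsLeading d D) :
    IsHomogeneousMap (algComponent d a) (L.cellDegree d (i + 1)) (L.cellDegree d i) D := by
  refine isHomogeneousMap_of_basis fun c => ?_
  have hweight : Finsupp.weight d (Pair.lead (c, 0)).total = L.cellDegree d (i + 1) c := by
    rw [Pair.total_lead, Pair.total, add_zero, cellDegree]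
  have hlow : low d (Pair.lead (c, 0)) ≤
      freeComponent (algComponent d a) (L.cellDegree d i) (L.cellDegree d (i + 1) c) :=
    monomialSpan_le fun p hp => by
      rw [← hweight, ← hp.1]
      exact elem_mem_freeComponent p
  have h := Submodule.add_mem _ (hlow (hD c)) (hweight ▸ elem_mem_freeComponent _)
  rwa [sub_add_cancel] at h

theorem augmentation_eq_zero_of_mem_freeComponent {γ : Γ} (hγ : γ ≠ 0) {x : L.CellModule 0}
    (hx : x ∈ freeComponent (algComponent d a) (L.cellDegree d 0) γ) : augmentation L x = 0 := by
  induction hx using Submodule.span_induction with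
  | mem x hx =>
    obtain ⟨c, δ, _, ⟨f, hf, rfl⟩, hδ, rfl⟩ := hx
    have hcoeff : coeff 0 f = 0 := by
      by_contra h
      have hδ₀ := hf h
      rw [map_zero] at hδ₀
      rw [← hδ₀, zero_add, c.eq_nil] at hδ
      exact hγ (hδ.symm.trans (map_zero _))
    rw [augmentation_single]
    exact (mk_mk_eq_coeff_smul f).trans (by rw [hcoeff, zero_smul])
  | zero => exact map_zero _
  | add x y _ _ hx hy => rw [map_add, hx, hy, add_zero]
  | smul t x _ hx => rw [LinearMap.map_smul_of_tower, hx, smul_zero]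

end Homogeneity

theorem exists_differentials [∀ i, Finite (L.Cell i)] (ha : a ≤ idealOfVars (Fin n) k)
    (hd : IsHomogeneousFor d a) :
    ∃ D : ∀ i, L.CellModule (i + 1) →ₗ[MvPolynomial (Fin n) k ⧸ a] L.CellModule i,
      (∀ i, IsLeading d (D i)) ∧ Function.Exact (D 0) (augmentation L) ∧
      ∀ i, Function.Exact (D (i + 1)) (D i) := by
  have haug : ∀ x ∈ monomialSpan (L.normalPairs 0), (augmentation L).restrictScalars k x = 0 →
      x = 0 := fun x hx => eq_zero_of_augmentation_eq_zero ha hx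
  let T (i : ℕ) := {D : L.CellModule (i + 1) →ₗ[MvPolynomial (Fin n) k ⧸ a] L.CellModule i //
    IsLeading d D ∧ IsStrict d D}
  have step (i : ℕ) (D : T i) : ∃ D' : T (i + 1), ∀ x, D.1 (D'.1 x) = 0 := by
    obtain ⟨D', hD', hDD'⟩ := D.2.1.exists_next hd D.2.2
    exact ⟨⟨D', hD', hD'.isStrict hd (f := D.1.restrictScalars k)
      (fun x => D.2.1.eq_zero_of_map_eq_zero hd) hDD'⟩, hDD'⟩
  let D₀ : T 0 := ⟨firstDiff L, isLeading_firstDiff,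
    isLeading_firstDiff.isStrict hd haug augmentation_firstDiff⟩
  obtain ⟨D₁, hD₁⟩ := step 0 D₀
  obtain ⟨D, hD₀, hD⟩ := exists_dependent_sequence
    (fun i (D : T i) (D' : T (i + 1)) => ∀ x, D.1 (D'.1 x) = 0) hD₁
    fun i _ D' _ => step (i + 1) D'
  refine ⟨fun i => (D i).1, fun i => (D i).2.1, ?_, fun i => ?_⟩
  · simp only [hD₀]
    exact isLeading_firstDiff.exact hd haug augmentation_firstDiff
  · exact (D (i + 1)).2.1.exact hd (f := (D i).1.restrictScalars k)
      (fun x => (D i).2.1.eq_zero_of_map_eq_zero hd) (hD i)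

/-- The graded free resolution of the residue field with basis the cells. -/
noncomputable def cellResolution
    {D : ∀ i, L.CellModule (i + 1) →ₗ[MvPolynomial (Fin n) k ⧸ a] L.CellModule i}
    (hD : ∀ i, IsLeading d (D i)) (hD₀ : Function.Exact (D 0) (augmentation L))
    (hDD : ∀ i, Function.Exact (D (i + 1)) (D i)) :
    GradedFreeResolution.{u, 0, w} (algComponent d a) (augIdeal a) where
  basis := L.Cell
  deg := L.cellDegree d
  diff := D
  aug := augmentation L
  diff_homogeneous i := (hD i).isHomogeneousMap
  aug_homogeneous _ hγ _ := augmentation_eq_zero_of_mem_freeComponent hγ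
  aug_surjective := augmentation_surjective
  exact_zero := hD₀
  exact_succ := hDD

section Tor

variable (P : GradedFreeResolution.{u, v, w} (algComponent d a) (augIdeal a)) (i : ℕ) (γ : Γ)

theorem tensorComponent_le : P.tensorComponent i γ ≤ Submodule.span k
    (Set.range fun b : {b // P.deg i b = γ} =>
      (1 : (MvPolynomial (Fin n) k ⧸ a) ⧸ augIdeal a) ⊗ₜ[MvPolynomial (Fin n) k ⧸ a]
        Finsupp.single b.1 (1 : MvPolynomial (Fin n) k ⧸ a)) := by
  rw [GradedFreeResolution.tensorComponent, Submodule.map_le_iff_le_comap, freeComponent,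
    Submodule.span_le]
  rintro _ ⟨b, δ, _, ⟨f, hf, rfl⟩, hγ, rfl⟩
  refine Submodule.mem_comap.2 ((one_tmul_single_of_mk_eq b (mk_mk_eq_coeff_smul f)).symm ▸ ?_ :
    (1 : (MvPolynomial (Fin n) k ⧸ a) ⧸ augIdeal a) ⊗ₜ[MvPolynomial (Fin n) k ⧸ a]
      Finsupp.single b (Ideal.Quotient.mk a f) ∈ Submodule.span k _)
  rcases eq_or_ne (coeff 0 f) 0 with h₀ | h₀
  · rw [h₀, zero_smul]
    exact Submodule.zero_mem _
  · have hδ := hf h₀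
    rw [map_zero] at hδ
    rw [← hδ, zero_add] at hγ
    exact Submodule.smul_mem _ _ (Submodule.subset_span ⟨⟨b, hγ⟩, rfl⟩)

theorem finite_tensorComponent [Finite {b // P.deg i b = γ}] :
    Module.Finite k (P.tensorComponent i γ) :=
  have := FiniteDimensional.span_of_finite k (Set.finite_range fun b : {b // P.deg i b = γ} =>
    (1 : (MvPolynomial (Fin n) k ⧸ a) ⧸ augIdeal a) ⊗ₜ[MvPolynomial (Fin n) k ⧸ a]
      Finsupp.single b.1 (1 : MvPolynomial (Fin n) k ⧸ a))
  Submodule.finiteDimensional_of_le (tensorComponent_le P i γ)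

theorem finrank_tensorComponent_le [Finite {b // P.deg i b = γ}] :
    Module.finrank k (P.tensorComponent i γ) ≤ Nat.card {b // P.deg i b = γ} := by
  have := Fintype.ofFinite {b // P.deg i b = γ}
  rw [Nat.card_eq_fintype_card]
  have := FiniteDimensional.span_of_finite k (Set.finite_range fun b : {b // P.deg i b = γ} =>
    (1 : (MvPolynomial (Fin n) k ⧸ a) ⧸ augIdeal a) ⊗ₜ[MvPolynomial (Fin n) k ⧸ a]
      Finsupp.single b.1 (1 : MvPolynomial (Fin n) k ⧸ a))
  exact (Submodule.finrank_mono (tensorComponent_le P i γ)).trans (finrank_range_le_card _)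

end Tor

theorem finrank_tor_le_card (ha : a ≤ idealOfVars (Fin n) k) (hd : IsHomogeneousFor d a)
    (L : LetterSystem (initialMonomials a)) [∀ i, Finite (L.Cell i)]
    (R : GradedFreeResolution.{u, v, w} (algComponent d a) (augIdeal a)) (i : ℕ) (γ : Γ) :
    Module.Finite k (R.Tor i γ) ∧ Module.finrank k (R.Tor i γ) ≤
      Nat.card {c : L.Cell i // L.cellDegree d i c = γ} := by
  classical
  obtain ⟨D, hD, hD₀, hDD⟩ := exists_differentials (L := L) ha hd
  let P := cellResolution hD hD₀ hDD
  let _ := algComponentDecomposition hd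
  let _ : GradedAlgebra (algComponent d a) := { algComponent_gradedMonoid with }
  have : Finite {b // P.deg i b = γ} :=
    inferInstanceAs (Finite {c : L.Cell i // L.cellDegree d i c = γ})
  have := finite_tensorComponent P i γ
  exact (GradedFreeResolution.finrank_tor_le (P := P) i γ).imp_right
    (le_trans · (finrank_tensorComponent_le P i γ))

end LetterSystem

/-! ### The letter system of minimal fully attached tuples -/

section AttachedTuples

variable {k : Type u} [Field k] {n : ℕ} {a : Ideal (MvPolynomial (Fin n) k)}

theorem single_le_iff_mem_support {j : Fin n} {w : Fin n →₀ ℕ} :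
    Finsupp.single j 1 ≤ w ↔ j ∈ w.support := by
  rw [Finsupp.single_le_iff, Finsupp.mem_support_iff, Nat.one_le_iff_ne_zero]

theorem mem_support_or_mem_support_of_single_le_add {j : Fin n} {v w : Fin n →₀ ℕ}
    (h : Finsupp.single j 1 ≤ v + w) : j ∈ v.support ∨ j ∈ w.support :=
  Finset.mem_union.1 (Finsupp.support_add (single_le_iff_mem_support.1 h))

theorem IsMinFullyAttached.two_le_length {t : List (Fin n →₀ ℕ)}
    (h : IsMinFullyAttached a t) : 2 ≤ t.length :=
  match t, h with
  | _ :: _ :: _, _ => Nat.le_add_left _ _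

theorem isMinFullyAttached_pair_iff {x w : Fin n →₀ ℕ} :
    IsMinFullyAttached a [x, w] ↔ ∃ i : Fin n, x = Finsupp.single i 1 ∧
      Finsupp.single i 1 ∈ standardMonomials a ∧ w ∈ standardMonomials a ∧
      Finsupp.single i 1 + w ∈ minGenInitial a ∧ ∀ j ∈ w.support, i ≤ j := by
  constructor
  · rintro ⟨i, w₂, hpair, h⟩
    simp only [List.cons.injEq, and_true] at hpair
    obtain ⟨rfl, rfl⟩ := hpair
    exact ⟨i, rfl, h⟩
  · rintro ⟨i, rfl, h⟩
    exact ⟨i, w, rfl, h⟩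

theorem isMinFullyAttached_append_iff {pre : List (Fin n →₀ ℕ)} {b c : Fin n →₀ ℕ}
    (hpre : pre ≠ []) :
    IsMinFullyAttached a (pre ++ [b, c]) ↔ IsMinFullyAttached a (pre ++ [b]) ∧
      c ∈ standardMonomials a ∧
      (∃ i : Fin n, pre.head? = some (Finsupp.single i 1) ∧ ∀ j ∈ c.support, i < j) ∧
      AttachingCondition a (IsMinFullyAttached a) pre b c ∧
      ∀ c' : Fin n →₀ ℕ, c' ≤ c → c' ≠ c →
        ¬ AttachingCondition a (IsMinFullyAttached a) pre b c' := by
  obtain ⟨l, hl⟩ := Nat.exists_eq_add_one_of_ne_zero (mt List.length_eq_zero_iff.1 hpre)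
  have hprev (u : Fin n →₀ ℕ) : IsMinFullyAttached a (pre ++ [u]) ↔
      IsMinFullyAttachedOfLength a (l + 2) (pre ++ [u]) := by
    rw [IsMinFullyAttached, List.length_append, hl]
    rfl
  have hlast : IsMinFullyAttached a (pre ++ [b, c]) ↔
      IsMinFullyAttachedOfLength a (l + 3) (pre ++ [b, c]) := by
    rw [IsMinFullyAttached, List.length_append, hl]
    rfl
  simp only [hlast, AttachingCondition, hprev]
  constructor
  · rintro ⟨pre', b', c', htuple, h⟩
    obtain ⟨rfl, hbc⟩ := List.append_inj' htuple rfl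
    simp only [List.cons.injEq, and_true] at hbc
    obtain ⟨rfl, rfl⟩ := hbc
    exact h
  · exact fun h => ⟨pre, b, c, rfl, h⟩

theorem IsMinFullyAttached.last_mem {t : List (Fin n →₀ ℕ)} {c : Fin n →₀ ℕ}
    (h : IsMinFullyAttached a (t ++ [c])) : c ∈ standardMonomials a := by
  rcases List.eq_nil_or_concat' t with rfl | ⟨pre, b, rfl⟩
  · exact absurd h.two_le_length (by simp)
  rcases eq_or_ne pre [] with rfl | hpre
  · obtain ⟨i, -, -, hc, -⟩ := isMinFullyAttached_pair_iff.1 h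
    exact hc
  · rw [List.append_assoc] at h
    exact ((isMinFullyAttached_append_iff hpre).1 h).2.1

theorem IsMinFullyAttached.exists_eq_cons {t : List (Fin n →₀ ℕ)} {c : Fin n →₀ ℕ}
    (h : IsMinFullyAttached a (t ++ [c])) : ∃ (i : Fin n) (s : List (Fin n →₀ ℕ)),
      t = Finsupp.single i 1 :: s ∧ (∀ j ∈ c.support, i ≤ j) ∧
      (s ≠ [] → ∀ j ∈ c.support, i < j) := by
  rcases List.eq_nil_or_concat' t with rfl | ⟨pre, b, rfl⟩
  · exact absurd h.two_le_length (by simp)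
  rcases eq_or_ne pre [] with rfl | hpre
  · obtain ⟨i, rfl, -, -, -, hle⟩ := isMinFullyAttached_pair_iff.1 h
    exact ⟨i, [], rfl, hle, absurd rfl⟩
  · rw [List.append_assoc] at h
    obtain ⟨-, -, ⟨i, hi, hlt⟩, -⟩ := (isMinFullyAttached_append_iff hpre).1 h
    obtain ⟨s, rfl⟩ := List.head?_eq_some_iff.1 hi
    exact ⟨i, s ++ [b], rfl, fun j hj => (hlt j hj).le, fun _ => hlt⟩

/-- The condition on consecutive blocks of a cell, a block being a single variable or a minimal
fully attached tuple: `t'` may follow `t`. Every block may follow the empty list. -/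
def MayFollow (t t' : List (Fin n →₀ ℕ)) : Prop :=
  t.headD 0 ≼[MonomialOrder.degLex] t'.headD 0 ∧
    (t.length = 1 → t.headD 0 ≺[MonomialOrder.degLex] t'.headD 0)

theorem mayFollow_nil (t : List (Fin n →₀ ℕ)) : MayFollow [] t :=
  ⟨by simpa only [List.headD_nil, map_zero] using MonomialOrder.zero_le _ _,
    fun h => absurd h (by simp)⟩

theorem mayFollow_single_iff {i j : Fin n} {s : List (Fin n →₀ ℕ)} :
    MayFollow (Finsupp.single i 1 :: s) [Finsupp.single j 1] ↔ j ≤ i ∧ (s = [] → j < i) := by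
  simp only [MayFollow, List.headD_cons, List.length_cons, Nat.add_eq_right,
    List.length_eq_zero_iff, MonomialOrder.degLex_single_le_iff,
    MonomialOrder.degLex_single_lt_iff]

theorem MayFollow.trans {t t' t'' : List (Fin n →₀ ℕ)} (h : MayFollow t t')
    (h' : MayFollow t' t'') : MayFollow t t'' :=
  ⟨h.1.trans h'.1, fun ht => (h.2 ht).trans_le h'.1⟩

theorem IsMinFullyAttached.notMem_support {t : List (Fin n →₀ ℕ)} {c : Fin n →₀ ℕ}
    (h : IsMinFullyAttached a (t ++ [c])) {j : Fin n} (hj : MayFollow t [Finsupp.single j 1]) :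
    j ∉ c.support := fun hjc => by
  obtain ⟨i, s, rfl, hle, hlt⟩ := h.exists_eq_cons
  obtain ⟨hji, hji'⟩ := mayFollow_single_iff.1 hj
  rcases eq_or_ne s [] with hs | hs
  · exact (hji' hs).not_ge (hle j hjc)
  · exact hji.not_gt (hlt hs j hjc)

theorem MayFollow.not_isMinFullyAttached {t : List (Fin n →₀ ℕ)} {j : Fin n}
    (hj : MayFollow t [Finsupp.single j 1]) :
    ¬ IsMinFullyAttached a (t ++ [Finsupp.single j 1]) := fun h =>
  h.notMem_support hj (single_le_iff_mem_support.1 le_rfl)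

theorem IsMinFullyAttached.mayFollow_or_add_mem {t : List (Fin n →₀ ℕ)} {c : Fin n →₀ ℕ}
    (h : IsMinFullyAttached a (t ++ [c])) {j : Fin n}
    (hj : MayFollow (t ++ [c]) [Finsupp.single j 1]) :
    MayFollow t [Finsupp.single j 1] ∨ c + Finsupp.single j 1 ∈ initialMonomials a := by
  obtain ⟨i, s, rfl, -, -⟩ := h.exists_eq_cons
  have hji := (mayFollow_single_iff.1 hj).1
  by_cases hs : s = [] → j < i
  · exact Or.inl (mayFollow_single_iff.2 ⟨hji, hs⟩)
  push Not at hs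
  obtain ⟨rfl, hij⟩ := hs
  obtain rfl := hij.antisymm hji
  obtain ⟨i', hi', -, -, hmin, -⟩ := isMinFullyAttached_pair_iff.1 h
  rw [add_comm, hi']
  exact Or.inr hmin.1

open Classical in
/-- The decomposition of a cell into blocks, the last block coming first: each letter is added to
the last block if the result is a minimal fully attached tuple, and forms a new block otherwise. -/
noncomputable def blocks (a : Ideal (MvPolynomial (Fin n) k)) :
    List (Fin n →₀ ℕ) → List (List (Fin n →₀ ℕ))
  | [] => []
  | u :: c =>
    if IsMinFullyAttached a ((blocks a c).headD [] ++ [u]) then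
      ((blocks a c).headD [] ++ [u]) :: (blocks a c).tail
    else [u] :: blocks a c

/-- The last block of a cell; it is empty for the empty cell. -/
noncomputable def lastBlock (a : Ideal (MvPolynomial (Fin n) k)) (c : List (Fin n →₀ ℕ)) :
    List (Fin n →₀ ℕ) :=
  (blocks a c).headD []

variable {c : List (Fin n →₀ ℕ)} {u : Fin n →₀ ℕ}

theorem blocks_cons_of_pos (h : IsMinFullyAttached a (lastBlock a c ++ [u])) :
    blocks a (u :: c) = (lastBlock a c ++ [u]) :: (blocks a c).tail :=
  if_pos h

theorem blocks_cons_of_neg (h : ¬ IsMinFullyAttached a (lastBlock a c ++ [u])) :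
    blocks a (u :: c) = [u] :: blocks a c :=
  if_neg h

theorem lastBlock_cons_of_pos (h : IsMinFullyAttached a (lastBlock a c ++ [u])) :
    lastBlock a (u :: c) = lastBlock a c ++ [u] := by
  rw [lastBlock, blocks_cons_of_pos h, List.headD_cons]

theorem lastBlock_cons_of_neg (h : ¬ IsMinFullyAttached a (lastBlock a c ++ [u])) :
    lastBlock a (u :: c) = [u] := by
  rw [lastBlock, blocks_cons_of_neg h, List.headD_cons]

/-- The letters that can be appended to a cell: those that extend the last block to a minimal
fully attached tuple, and variables that start a new block. -/
def attachedLetters (a : Ideal (MvPolynomial (Fin n) k)) (c : List (Fin n →₀ ℕ)) :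
    Set (Fin n →₀ ℕ) :=
  {u | IsMinFullyAttached a (lastBlock a c ++ [u]) ∨ ∃ j : Fin n, u = Finsupp.single j 1 ∧
    Finsupp.single j 1 ∈ standardMonomials a ∧ MayFollow (lastBlock a c) [Finsupp.single j 1]}

/-- Letters starting a new block have priority over letters extending the last one; among letters
of the same kind, larger ones have priority. -/
def attachedPrior (a : Ideal (MvPolynomial (Fin n) k)) (c : List (Fin n →₀ ℕ))
    (u u' : Fin n →₀ ℕ) : Prop :=
  (¬ IsMinFullyAttached a (lastBlock a c ++ [u]) ∧ IsMinFullyAttached a (lastBlock a c ++ [u'])) ∨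
  ((IsMinFullyAttached a (lastBlock a c ++ [u]) ↔ IsMinFullyAttached a (lastBlock a c ++ [u'])) ∧
    u' ≺[MonomialOrder.degLex] u)

variable (a c) in
theorem isStrictTotalOrder_attachedPrior : IsStrictTotalOrder _ (attachedPrior a c) := by
  let rank (u : Fin n →₀ ℕ) : Prop ×ₗ (MonomialOrder.degLex (σ := Fin n)).synᵒᵈ :=
    toLex (IsMinFullyAttached a (lastBlock a c ++ [u]),
      OrderDual.toDual (MonomialOrder.degLex.toSyn u))
  have hrank : Function.Injective rank := fun u v h =>
    MonomialOrder.degLex.toSyn.injective (Prod.mk.inj (toLex_inj.1 h)).2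
  have hlt (p q : Prop) : p < q ↔ ¬ p ∧ q := by
    simp only [lt_iff_le_not_ge, le_Prop_eq]
    tauto
  have hprior : attachedPrior a c = ⇑(⟨rank, hrank⟩ : _ ↪ _) ⁻¹'o (· < ·) := by
    ext u v
    simp only [attachedPrior, Order.Preimage, Function.Embedding.coeFn_mk, rank,
      Prod.Lex.toLex_lt_toLex, OrderDual.toDual_lt_toDual, eq_iff_iff, hlt]
  rw [hprior]
  exact (RelEmbedding.preimage _ _).isStrictTotalOrder

/-! #### Letters lie in the colon ideals -/

theorem mem_colonSet_of_isMinFullyAttached (hu : IsMinFullyAttached a (lastBlock a c ++ [u])) :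
    u ∈ colonSet (initialMonomials a) (attachedLetters a) (attachedPrior a) c := by
  match c with
  | [] => exact hu.last_mem.1
  | g :: b =>
    by_cases hg : IsMinFullyAttached a (lastBlock a b ++ [g])
    · rw [lastBlock_cons_of_pos hg, List.append_assoc] at hu
      obtain ⟨i, s, hs, -, -⟩ := hg.exists_eq_cons
      obtain ⟨-, -, -, hI | ⟨-, u', v, heq, hlt, hu'⟩, -⟩ :=
        (isMinFullyAttached_append_iff (hs ▸ List.cons_ne_nil _ _)).1 hu
      · exact Or.inl hI
      · exact Or.inr ⟨u', Or.inl hu', Or.inr ⟨iff_of_true hu' hg, hlt⟩, heq ▸ le_self_add⟩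
    · rw [lastBlock_cons_of_neg hg] at hu
      obtain ⟨i, rfl, -, -, hmin, -⟩ := isMinFullyAttached_pair_iff.1 hu
      exact Or.inl hmin.1

theorem single_mem_colonSet_of_mayFollow (hc : IsCell (attachedLetters a) c) {j : Fin n}
    (hj : Finsupp.single j 1 ∈ standardMonomials a)
    (hcj : MayFollow (lastBlock a c) [Finsupp.single j 1]) :
    Finsupp.single j 1 ∈
      colonSet (initialMonomials a) (attachedLetters a) (attachedPrior a) c := by
  match c, hc with
  | [], _ => exact hj.1
  | g :: b, hc =>
    by_cases hg : IsMinFullyAttached a (lastBlock a b ++ [g])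
    · rw [lastBlock_cons_of_pos hg] at hcj
      rcases hg.mayFollow_or_add_mem hcj with hbj | hI
      · exact Or.inr ⟨_, Or.inr ⟨j, rfl, hj, hbj⟩, Or.inl ⟨hbj.not_isMinFullyAttached, hg⟩,
          le_add_self⟩
      · exact Or.inl hI
    · obtain ⟨m, rfl, -, hbm⟩ := hc.2.resolve_left hg
      rw [lastBlock_cons_of_neg hg] at hcj
      have hbj := hbm.trans hcj
      exact Or.inr ⟨_, Or.inr ⟨j, rfl, hj, hbj⟩,
        Or.inr ⟨iff_of_false hbj.not_isMinFullyAttached hg, hcj.2 rfl⟩, le_add_self⟩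

theorem attachedLetters_subset_colonSet (hc : IsCell (attachedLetters a) c) :
    attachedLetters a c ⊆
      colonSet (initialMonomials a) (attachedLetters a) (attachedPrior a) c := by
  rintro u (hu | ⟨j, rfl, hj, hcj⟩)
  · exact mem_colonSet_of_isMinFullyAttached hu
  · exact single_mem_colonSet_of_mayFollow hc hj hcj

/-! #### Letters generate the colon ideals -/

section Generation

variable {b s : List (Fin n →₀ ℕ)} {g w : Fin n →₀ ℕ} {i m : Fin n}

theorem attachingCondition_of_mem_colonSet (hb : lastBlock a b = Finsupp.single i 1 :: s)
    (hg : IsMinFullyAttached a (lastBlock a b ++ [g])) (hsupp : ∀ j ∈ w.support, i < j)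
    (hw : w ∈ colonSet (initialMonomials a) (attachedLetters a) (attachedPrior a) (g :: b)) :
    AttachingCondition a (IsMinFullyAttached a) (lastBlock a b) g w := by
  by_cases hI : g + w ∈ initialMonomials a
  · exact Or.inl hI
  obtain ⟨u, hu, ⟨hu', -⟩ | ⟨hiff, hlt⟩, hle⟩ := hw.resolve_left hI
  · exfalso
    obtain ⟨j, rfl, -, hj⟩ := hu.resolve_left hu'
    rcases mem_support_or_mem_support_of_single_le_add hle with hjg | hjw
    · exact hg.notMem_support hj hjg
    · rw [hb, mayFollow_single_iff] at hj
      exact (hsupp j hjw).not_ge hj.1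
  · obtain ⟨v, hv⟩ := exists_add_of_le hle
    exact Or.inr ⟨⟨fun h => hg.last_mem.1 (add_eq_zero.1 h).1, hI⟩, u, v, hv, hlt, hiff.2 hg⟩

theorem exists_le_isMinFullyAttached_append
    (hg : IsMinFullyAttached a (Finsupp.single i 1 :: s ++ [g])) (hI : w ∉ initialMonomials a)
    (hsupp : ∀ j ∈ w.support, i < j)
    (hw : AttachingCondition a (IsMinFullyAttached a) (Finsupp.single i 1 :: s) g w) :
    ∃ u ≤ w, IsMinFullyAttached a (Finsupp.single i 1 :: s ++ [g, u]) := by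
  obtain ⟨u, hle, hmin⟩ := exists_minimal_le_of_wellFoundedLT _ w hw
  have hu : u ≠ 0 := by
    rintro rfl
    rcases hmin.1 with h | ⟨-, u', v, heq, hlt, -⟩
    · exact hg.last_mem.2 (by rwa [add_zero] at h)
    · rw [add_zero] at heq
      exact hlt.not_ge (MonomialOrder.degLex.toSyn_monotone (heq ▸ le_self_add))
  exact ⟨u, hle, (isMinFullyAttached_append_iff (List.cons_ne_nil _ _)).2
    ⟨hg, ⟨hu, fun h => hI (mem_initialMonomials_of_le h hle)⟩,
      ⟨i, rfl, fun j hj => hsupp j (Finsupp.support_mono hle hj)⟩, hmin.1,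
      fun u' hle' hne h => hne (hle'.antisymm (hmin.2 h hle'))⟩⟩

theorem single_add_mem_of_mem_colonSet
    (hm : ¬ IsMinFullyAttached a (lastBlock a b ++ [Finsupp.single m 1]))
    (hsupp : ∀ j ∈ w.support, m ≤ j)
    (hw : w ∈ colonSet (initialMonomials a) (attachedLetters a) (attachedPrior a)
      (Finsupp.single m 1 :: b)) :
    Finsupp.single m 1 + w ∈ initialMonomials a := by
  refine hw.resolve_right ?_
  rintro ⟨u, hu, ⟨-, h⟩ | ⟨hiff, hlt⟩, hle⟩
  · exact hm h
  obtain ⟨j, rfl, -, -⟩ := hu.resolve_left (mt hiff.1 hm)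
  rw [MonomialOrder.degLex_single_lt_iff] at hlt
  rcases mem_support_or_mem_support_of_single_le_add hle with hjm | hjw
  · exact hlt.ne (Finsupp.mem_support_single _ _ _ |>.1 hjm).1
  · exact hlt.not_ge (hsupp j hjw)

theorem exists_le_isMinFullyAttached_pair (hm : Finsupp.single m 1 ∈ standardMonomials a)
    (hI : w ∉ initialMonomials a) (hsupp : ∀ j ∈ w.support, m ≤ j)
    (hw : Finsupp.single m 1 + w ∈ initialMonomials a) :
    ∃ u ≤ w, IsMinFullyAttached a [Finsupp.single m 1, u] := by
  obtain ⟨q, hqle, hq⟩ := exists_minimal_le_of_wellFoundedLT (· ∈ initialMonomials a) _ hw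
  have hmq : Finsupp.single m 1 ≤ q := by
    by_contra h
    rw [single_le_iff_mem_support, Finsupp.notMem_support_iff] at h
    refine hI (mem_initialMonomials_of_le hq.1 fun j => ?_)
    rcases eq_or_ne j m with rfl | hj
    · exact h ▸ Nat.zero_le _
    · simpa only [Finsupp.add_apply, Finsupp.single_eq_of_ne hj, zero_add] using hqle j
  obtain ⟨u, rfl⟩ := exists_add_of_le hmq
  have hle : u ≤ w := le_of_add_le_add_left hqle
  have hu : u ≠ 0 := by
    rintro rfl
    exact hm.2 (add_zero (Finsupp.single m 1) ▸ hq.1)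
  exact ⟨u, hle, isMinFullyAttached_pair_iff.2 ⟨m, rfl, hm,
    ⟨hu, fun h => hI (mem_initialMonomials_of_le h hle)⟩, hq,
    fun j hj => hsupp j (Finsupp.support_mono hle hj)⟩⟩

theorem exists_attachedLetter_le (hc : IsCell (attachedLetters a) c)
    (hw : w ∈ colonSet (initialMonomials a) (attachedLetters a) (attachedPrior a) c)
    (hI : w ∉ initialMonomials a) : ∃ u ∈ attachedLetters a c, u ≤ w := by
  by_cases hstart : ∃ j ∈ w.support, MayFollow (lastBlock a c) [Finsupp.single j 1]
  · obtain ⟨j, hj, hcj⟩ := hstart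
    have hle := single_le_iff_mem_support.2 hj
    exact ⟨_, Or.inr ⟨j, rfl, ⟨Finsupp.single_ne_zero.2 one_ne_zero,
      fun h => hI (mem_initialMonomials_of_le h hle)⟩, hcj⟩, hle⟩
  push Not at hstart
  match c, hc with
  | [], _ =>
    obtain ⟨j, hj⟩ := Finsupp.support_nonempty_iff.2 hw
    exact absurd (mayFollow_nil _) (hstart j hj)
  | g :: b, hc =>
    by_cases hg : IsMinFullyAttached a (lastBlock a b ++ [g])
    · obtain ⟨i, s, hb, -, -⟩ := hg.exists_eq_cons
      have hsupp : ∀ j ∈ w.support, i < j := fun j hj => by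
        by_contra! hji
        refine hstart j hj ?_
        rw [lastBlock_cons_of_pos hg, hb]
        exact mayFollow_single_iff.2 ⟨hji, fun h => absurd h (by simp)⟩
      have hatt := attachingCondition_of_mem_colonSet hb hg hsupp hw
      rw [hb] at hatt
      obtain ⟨u, hle, hu⟩ := exists_le_isMinFullyAttached_append (hb ▸ hg) hI hsupp hatt
      exact ⟨u, Or.inl (by rwa [lastBlock_cons_of_pos hg, hb, List.append_assoc]), hle⟩
    · obtain ⟨m, rfl, hm, -⟩ := hc.2.resolve_left hg
      have hsupp : ∀ j ∈ w.support, m ≤ j := fun j hj => by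
        by_contra! hjm
        refine hstart j hj ?_
        rw [lastBlock_cons_of_neg hg]
        exact mayFollow_single_iff.2 ⟨hjm.le, fun _ => hjm⟩
      obtain ⟨u, hle, hu⟩ := exists_le_isMinFullyAttached_pair hm hI hsupp
        (single_add_mem_of_mem_colonSet hg hsupp hw)
      exact ⟨u, Or.inl (by rwa [lastBlock_cons_of_neg hg]), hle⟩

end Generation

/-- The letter system of minimal fully attached tuples. -/
noncomputable def attachedSystem (a : Ideal (MvPolynomial (Fin n) k)) :
    LetterSystem (initialMonomials a) where
  letters := attachedLetters a
  prior := attachedPrior a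
  isStrictTotalOrder_prior := isStrictTotalOrder_attachedPrior a
  letters_subset _ := attachedLetters_subset_colonSet
  exists_letter_le _ hc _ := exists_attachedLetter_le hc

end AttachedTuples

/-! ### Counting cells -/

theorem eq_of_filter_eq {α β : Type*} [DecidableEq β] {p : α → β} {r : α → α → Prop}
    (hr : ∀ s t, p s ≠ p t → r s t → ¬ r t s) : ∀ {B B' : List α}, B.Pairwise r → B'.Pairwise r →
      (∀ b, B.filter (p · = b) = B'.filter (p · = b)) → B = B'
  | [], [], _, _, _ => rfl
  | [], t :: _, _, _, hfilter => by simpa using hfilter (p t)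
  | t :: _, [], _, _, hfilter => by simpa using hfilter (p t)
  | t :: B, t' :: B', hB, hB', hfilter => by
    rw [List.pairwise_cons] at hB hB'
    have hmem (s : α) : s ∈ t :: B ↔ s ∈ t' :: B' := by
      simpa only [List.mem_filter, decide_true, and_true] using
        (congrArg (s ∈ ·) (hfilter (p s))).to_iff
    have hp : p t = p t' := by
      by_contra hne
      have ht : t ∈ B' := List.mem_of_ne_of_mem (fun h => hne (h ▸ rfl))
        ((hmem t).1 List.mem_cons_self)
      have ht' : t' ∈ B := List.mem_of_ne_of_mem (fun h => hne (h ▸ rfl))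
        ((hmem t').2 List.mem_cons_self)
      exact hr t t' hne (hB.1 t' ht') (hB'.1 t ht)
    have htt : t = t' := by
      have h := hfilter (p t)
      simp only [List.filter_cons, hp, decide_true, if_true] at h
      exact (List.cons.inj h).1
    subst htt
    refine congrArg (t :: ·) (eq_of_filter_eq hr hB.2 hB'.2 fun b => ?_)
    have h := hfilter b
    simp only [List.filter_cons] at h
    split_ifs at h
    exacts [(List.cons.inj h).2, h]

section CellWords

variable {k : Type u} [Field k] {n : ℕ} {a : Ideal (MvPolynomial (Fin n) k)}
  {c c' : List (Fin n →₀ ℕ)}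

theorem flatten_reverse_blocks (c : List (Fin n →₀ ℕ)) :
    (blocks a c).reverse.flatten = c.reverse := by
  induction c with
  | nil => rfl
  | cons u c ih =>
    rw [blocks, List.reverse_cons, ← ih]
    split_ifs
    · cases blocks a c <;> simp
    · simp

theorem blocks_injective : Function.Injective (blocks a) := fun c c' h => by
  rw [← List.reverse_inj, ← flatten_reverse_blocks (a := a), h, flatten_reverse_blocks]

theorem MayFollow.append {t t' : List (Fin n →₀ ℕ)} (h : MayFollow t t') (ht' : t' ≠ [])
    (s : List (Fin n →₀ ℕ)) : MayFollow t (t' ++ s) := by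
  obtain ⟨x, t', rfl⟩ := List.exists_cons_of_ne_nil ht'
  exact h

theorem exists_eq_single_or_isMinFullyAttached_of_mem_blocks
    (hc : IsCell (attachedLetters a) c) :
    ∀ t ∈ blocks a c, (∃ j : Fin n, t = [Finsupp.single j 1]) ∨ IsMinFullyAttached a t := by
  induction c with
  | nil => exact fun t ht => absurd ht List.not_mem_nil
  | cons u c ih =>
    by_cases h : IsMinFullyAttached a (lastBlock a c ++ [u])
    · rw [blocks_cons_of_pos h, List.forall_mem_cons]
      exact ⟨Or.inr h, fun t ht => ih hc.1 t (List.mem_of_mem_tail ht)⟩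
    · obtain ⟨j, rfl, -⟩ := hc.2.resolve_left h
      rw [blocks_cons_of_neg h, List.forall_mem_cons]
      exact ⟨Or.inl ⟨j, rfl⟩, ih hc.1⟩

theorem pairwise_blocks (hc : IsCell (attachedLetters a) c) :
    (blocks a c).Pairwise fun t t' => MayFollow t' t := by
  induction c with
  | nil => exact List.Pairwise.nil
  | cons u c ih =>
    specialize ih hc.1
    by_cases h : IsMinFullyAttached a (lastBlock a c ++ [u])
    · rw [blocks_cons_of_pos h]
      obtain ⟨i, s, hs, -⟩ := h.exists_eq_cons
      rw [lastBlock] at hs ⊢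
      cases hblocks : blocks a c with
      | nil => exact List.pairwise_singleton _ _
      | cons t B =>
        rw [hblocks] at hs ih
        rw [List.headD_cons] at hs
        rw [List.pairwise_cons] at ih
        exact List.pairwise_cons.2
          ⟨fun t' ht' => (ih.1 t' ht').append (hs ▸ List.cons_ne_nil _ _) [u], ih.2⟩
    · obtain ⟨j, rfl, -, hj⟩ := hc.2.resolve_left h
      rw [blocks_cons_of_neg h]
      rw [lastBlock] at hj
      refine List.pairwise_cons.2 ⟨?_, ih⟩
      cases hblocks : blocks a c with
      | nil => exact fun t ht => absurd ht List.not_mem_nil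
      | cons t B =>
        rw [hblocks] at hj ih
        exact List.forall_mem_cons.2
          ⟨hj, fun t' ht' => ((List.pairwise_cons.1 ih).1 t' ht').trans hj⟩

/-- A variable as a block. -/
noncomputable def singleBlock : Fin n ↪ List (Fin n →₀ ℕ) :=
  ⟨fun j => [Finsupp.single j 1], fun _ _ h =>
    Finsupp.single_left_injective one_ne_zero (List.cons.inj h).1⟩

/-- The variables that form a block of a cell. -/
noncomputable def singleBlocks (a : Ideal (MvPolynomial (Fin n) k)) (c : List (Fin n →₀ ℕ)) :
    Finset (Fin n) :=
  {j | singleBlock j ∈ blocks a c}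

/-- The word formed by the blocks of a cell that are minimal fully attached tuples. -/
noncomputable def cellWord (a : Ideal (MvPolynomial (Fin n) k)) (c : List (Fin n →₀ ℕ)) :
    List (List (Fin n →₀ ℕ)) :=
  ((blocks a c).filter fun t => ¬ t.length = 1).reverse

theorem cellWord_mem_language (hc : IsCell (attachedLetters a) c) :
    cellWord a c ∈ language a := by
  refine ⟨fun t ht => ?_, List.Pairwise.isChain ?_⟩
  · obtain ⟨hmem, hlength⟩ := List.mem_filter.1 (List.mem_reverse.1 ht)
    refine (exists_eq_single_or_isMinFullyAttached_of_mem_blocks hc t hmem).resolve_left ?_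
    rintro ⟨j, rfl⟩
    exact of_decide_eq_true hlength rfl
  · rw [cellWord, List.pairwise_reverse]
    refine ((pairwise_blocks hc).filter _).imp ?_
    rintro t' t h ⟨x, y, s, s', rfl, rfl, hlt⟩
    exact h.1.not_gt hlt

theorem pairwise_filter_blocks (hc : IsCell (attachedLetters a) c) :
    ((blocks a c).filter fun t => t.length = 1).Pairwise fun t t' =>
      t'.headD 0 ≺[MonomialOrder.degLex] t.headD 0 :=
  ((pairwise_blocks hc).filter _).imp_of_mem fun _ ht' h =>
    h.2 (of_decide_eq_true (List.mem_filter.1 ht').2)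

theorem nodup_filter_blocks (hc : IsCell (attachedLetters a) c) :
    ((blocks a c).filter fun t => t.length = 1).Nodup :=
  (pairwise_filter_blocks hc).imp fun hlt heq =>
    hlt.ne (congrArg (fun t => MonomialOrder.degLex.toSyn (t.headD 0)) heq.symm)

theorem toFinset_filter_blocks (hc : IsCell (attachedLetters a) c) :
    ((blocks a c).filter fun t => t.length = 1).toFinset =
      (singleBlocks a c).map singleBlock := by
  ext t
  simp only [List.mem_toFinset, List.mem_filter, decide_eq_true_eq, Finset.mem_map,
    singleBlocks, Finset.mem_filter, Finset.mem_univ, true_and]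
  constructor
  · rintro ⟨ht, hlength⟩
    rcases exists_eq_single_or_isMinFullyAttached_of_mem_blocks hc t ht with ⟨j, rfl⟩ | h
    · exact ⟨j, ht, rfl⟩
    · exact absurd hlength (Nat.ne_of_gt h.two_le_length)
  · rintro ⟨j, hj, rfl⟩
    exact ⟨hj, rfl⟩

theorem filter_blocks_eq (hc : IsCell (attachedLetters a) c) (hc' : IsCell (attachedLetters a) c')
    (h : singleBlocks a c = singleBlocks a c') :
    (blocks a c).filter (fun t => t.length = 1) = (blocks a c').filter fun t => t.length = 1 :=
  List.Perm.eq_of_pairwise (fun _ _ _ _ hlt hgt => absurd hgt hlt.not_gt)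
    (pairwise_filter_blocks hc) (pairwise_filter_blocks hc')
    (List.perm_of_nodup_nodup_toFinset_eq (nodup_filter_blocks hc) (nodup_filter_blocks hc')
      (by rw [toFinset_filter_blocks hc, toFinset_filter_blocks hc', h]))

theorem eq_of_singleBlocks_eq_of_cellWord_eq (hc : IsCell (attachedLetters a) c)
    (hc' : IsCell (attachedLetters a) c') (hsingle : singleBlocks a c = singleBlocks a c')
    (hword : cellWord a c = cellWord a c') : c = c' := by
  refine blocks_injective (a := a) (eq_of_filter_eq (p := fun t => decide (t.length = 1))
    (fun s t hne hts hst => ?_) (pairwise_blocks hc) (pairwise_blocks hc') fun b => ?_)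
  · rcases Bool.eq_false_or_eq_true (decide (s.length = 1)) with hs | hs
    · exact hts.1.not_gt (hst.2 (of_decide_eq_true hs))
    · rw [hs, ne_comm, Bool.ne_false_iff, decide_eq_true_eq] at hne
      exact hst.1.not_gt (hts.2 hne)
  · cases b
    · simpa only [decide_eq_false_iff_not] using List.reverse_inj.1 hword
    · simpa only [decide_eq_true_eq] using filter_blocks_eq hc hc' hsingle

theorem sum_map_blocks (hc : IsCell (attachedLetters a) c) {N : Type*} [AddCommMonoid N]
    (f : List (Fin n →₀ ℕ) → N) : ((blocks a c).map f).sum =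
      ∑ j ∈ singleBlocks a c, f (singleBlock j) + ((cellWord a c).map f).sum := by
  rw [← List.sum_map_filter_add_sum_map_filter_not (fun t => t.length = 1) f (blocks a c),
    ← List.sum_toFinset _ (nodup_filter_blocks hc), toFinset_filter_blocks hc, Finset.sum_map,
    cellWord, List.map_reverse, List.sum_reverse]

theorem sum_cell (hc : IsCell (attachedLetters a) c) :
    c.sum = ∑ j ∈ singleBlocks a c, Finsupp.single j 1 + wordMonomial (cellWord a c) := by
  have hblocks := sum_map_blocks hc List.sum
  rw [← List.sum_reverse, ← List.map_reverse, ← List.sum_flatten, flatten_reverse_blocks,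
    List.sum_reverse] at hblocks
  exact hblocks.trans (congrArg (· + _) (Finset.sum_congr rfl fun _ _ => List.sum_singleton))

theorem length_cell (hc : IsCell (attachedLetters a) c) :
    c.length = (singleBlocks a c).card + wordLength (cellWord a c) := by
  have hblocks := sum_map_blocks hc List.length
  rw [← List.sum_reverse, ← List.map_reverse, ← List.length_flatten, flatten_reverse_blocks,
    List.length_reverse] at hblocks
  rwa [Finset.card_eq_sum_ones]

end CellWords

section Series

variable {k : Type u} [Field k] {n : ℕ} (a : Ideal (MvPolynomial (Fin n) k))

theorem finite_setOf_minimal (P : (Fin n →₀ ℕ) → Prop) : {w | Minimal P w}.Finite :=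
  WellQuasiOrderedLE.finite_of_isAntichain (setOfPred_minimal_antichain P)

theorem finite_isMinFullyAttachedOfLength :
    ∀ l, {t | IsMinFullyAttachedOfLength a l t}.Finite
  | 0 | 1 => Set.finite_empty
  | 2 => by
    refine ((Set.finite_univ (α := Fin n)).image2
      (fun i q => [Finsupp.single i 1, q - Finsupp.single i 1])
      (finite_setOf_minimal (· ∈ initialMonomials a))).subset ?_
    rintro t ⟨i, w, rfl, -, -, hmin, -⟩
    exact ⟨i, trivial, _, hmin, by simp only [add_tsub_cancel_left]⟩
  | l + 3 => by
    refine ((finite_isMinFullyAttachedOfLength (l + 2)).biUnion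
      (t := fun s => (s ++ [·]) '' {c | Minimal (AttachingCondition a
        (IsMinFullyAttachedOfLength a (l + 2)) s.dropLast (s.getLastD 0)) c})
      fun s _ => (finite_setOf_minimal _).image _).subset ?_
    rintro t ⟨pre, b, c, rfl, hprev, -, -, hatt, hmin⟩
    refine Set.mem_biUnion hprev ⟨c, ?_, List.append_assoc _ _ _⟩
    rw [Set.mem_ofPred_eq, List.dropLast_concat, List.getLastD_concat]
    refine ⟨hatt, fun c' hc' hle => ?_⟩
    by_contra hne
    exact hmin c' hle (fun heq => hne heq.ge) hc'

theorem finite_words (l : ℕ) : {W | W ∈ language a ∧ wordLength W ≤ l}.Finite := by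
  have hletters : {t | IsMinFullyAttached a t ∧ t.length ≤ l}.Finite :=
    ((Set.finite_Iic l).biUnion fun m _ => finite_isMinFullyAttachedOfLength a m).subset
      fun t ht => Set.mem_biUnion (x := t.length) ht.2 ht.1
  have := hletters.to_subtype
  refine ((List.finite_length_le {t | IsMinFullyAttached a t ∧ t.length ≤ l} l).image
    (List.map Subtype.val)).subset ?_
  rintro W ⟨hW, hl⟩
  have hle : ∀ t ∈ W, t.length ≤ l := fun t ht =>
    (List.le_sum_of_mem (List.mem_map_of_mem ht)).trans hl
  lift W to List {t // IsMinFullyAttached a t ∧ t.length ≤ l} using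
    fun t ht => ⟨hW.1 t ht, hle t ht⟩
  refine ⟨W, le_trans ?_ hl, rfl⟩
  have hpos : ∀ m ∈ (W.map Subtype.val).map List.length, 1 ≤ m := by
    simp only [List.mem_map, forall_exists_index, and_imp, forall_apply_eq_imp_iff₂]
    exact fun t _ => one_le_two.trans t.2.1.two_le_length
  simpa only [List.length_map, wordLength] using List.length_le_sum_of_one_le _ hpos

instance finite_cell (i : ℕ) : Finite ((attachedSystem a).Cell i) := by
  have := (finite_words a i).to_subtype
  refine Finite.of_injective (β := Finset (Fin n) × {W | W ∈ language a ∧ wordLength W ≤ i})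
    (fun c => (singleBlocks a c.1, ⟨cellWord a c.1, cellWord_mem_language c.2.1, ?_⟩))
    fun c c' h => ?_
  · exact (Nat.le_add_left _ _).trans_eq ((length_cell c.2.1).symm.trans c.2.2)
  · obtain ⟨hsingle, hword⟩ := Prod.mk.inj h
    exact Subtype.ext (eq_of_singleBlocks_eq_of_cellWord_eq c.2.1 c'.2.1 hsingle
      (Subtype.mk.inj hword))

/-- The words contributing to the coefficient of `x^α t^i` in `(∏_{j ∈ J} x_j t) F(x, t)`. -/
def wordsWith (J : Finset (Fin n)) (i : ℕ) (α : Fin n →₀ ℕ) : Set (List (List (Fin n →₀ ℕ))) :=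
  {W | W ∈ language a ∧ ∑ j ∈ J, Finsupp.single j 1 + wordMonomial W = α ∧
    J.card + wordLength W = i}

instance finite_wordsWith (J : Finset (Fin n)) (i : ℕ) (α : Fin n →₀ ℕ) :
    Finite (wordsWith a J i α) :=
  ((finite_words a i).subset fun _ hW =>
    ⟨hW.1, (Nat.le_add_left _ _).trans_eq hW.2.2⟩).to_subtype

theorem prod_X_mul_X {R : Type*} [CommSemiring R] {σ : Type*} (J : Finset σ) :
    ∏ j ∈ J, (PowerSeries.C (MvPowerSeries.X j) * PowerSeries.X :
      PowerSeries (MvPowerSeries σ R)) =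
      PowerSeries.C (MvPowerSeries.monomial (∑ j ∈ J, Finsupp.single j 1) 1) *
        PowerSeries.X ^ J.card := by
  simp only [Finset.prod_mul_distrib, Finset.prod_const, one_pow, ← map_prod, MvPowerSeries.X_def,
    MvPowerSeries.prod_monomial]

theorem coeff_prod_mul_wordSeries (J : Finset (Fin n)) (i : ℕ) (α : Fin n →₀ ℕ) :
    MvPowerSeries.coeff α (PowerSeries.coeff i
      ((∏ j ∈ J, (PowerSeries.C (MvPowerSeries.X j) * PowerSeries.X)) * wordSeries a)) =
      Nat.card (wordsWith a J i α) := by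
  classical
  rw [prod_X_mul_X, mul_assoc, PowerSeries.coeff_C_mul, PowerSeries.coeff_X_pow_mul',
    MvPowerSeries.coeff_monomial_mul, one_mul]
  split_ifs with hα hi
  · refine (congrArg (MvPowerSeries.coeff _) (PowerSeries.coeff_mk _ _)).trans
      (Nat.card_congr (Equiv.subtypeEquivRight fun W => and_congr_right fun _ => and_congr ?_ ?_))
    · rw [eq_tsub_iff_add_eq_of_le hα, add_comm]
    · rw [eq_tsub_iff_add_eq_of_le hi, add_comm]
  · have : IsEmpty (wordsWith a J i α) :=
      ⟨fun W => hi ((Nat.le_add_right _ _).trans_eq W.2.2.2)⟩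
    rw [map_zero, Nat.card_of_isEmpty]
  · have : IsEmpty (wordsWith a J i α) := ⟨fun W => hα (le_self_add.trans_eq W.2.2.1)⟩
    rw [Nat.card_of_isEmpty]

theorem coeff_boundSeries (i : ℕ) (α : Fin n →₀ ℕ) :
    MvPowerSeries.coeff α (PowerSeries.coeff i (boundSeries a)) =
      Nat.card (Σ J : Finset (Fin n), wordsWith a J i α) := by
  rw [boundSeries, Finset.prod_one_add, Finset.sum_mul, map_sum, map_sum, Finset.powerset_univ,
    Nat.card_sigma]
  exact Finset.sum_congr rfl fun J _ => coeff_prod_mul_wordSeries a J i α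

theorem finite_support_boundSeries (i : ℕ) : {α : Fin n →₀ ℕ |
    MvPowerSeries.coeff α (PowerSeries.coeff i (boundSeries a)) ≠ 0}.Finite := by
  refine (Set.finite_iUnion fun J : Finset (Fin n) => (finite_words a i).image
    fun W => ∑ j ∈ J, Finsupp.single j 1 + wordMonomial W).subset fun α hα => ?_
  rw [Set.mem_ofPred_eq, coeff_boundSeries] at hα
  obtain ⟨⟨J, W, hW, hα, hi⟩⟩ := (Nat.card_ne_zero.1 hα).1
  exact Set.mem_iUnion.2 ⟨J, W, ⟨hW, (Nat.le_add_left _ _).trans_eq hi⟩, hα⟩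

theorem card_cells_le (i : ℕ) (α : Fin n →₀ ℕ) :
    Nat.card {c : (attachedSystem a).Cell i // c.1.sum = α} ≤
      MvPowerSeries.coeff α (PowerSeries.coeff i (boundSeries a)) := by
  rw [coeff_boundSeries]
  refine Nat.card_le_card_of_injective (fun c => ⟨singleBlocks a c.1.1, cellWord a c.1.1,
    cellWord_mem_language c.1.2.1, (sum_cell c.1.2.1).symm.trans c.2,
    (length_cell c.1.2.1).symm.trans c.1.2.2⟩) fun c c' h => ?_
  have hsingle := congrArg Sigma.fst h
  have hword := congrArg (fun x => x.2.1) h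
  exact Subtype.ext (Subtype.ext (eq_of_singleBlocks_eq_of_cellWord_eq c.1.2.1 c'.1.2.1
    hsingle hword))

theorem card_le_finsum_mem {ι κ : Type*} [Finite ι] (g : ι → κ) {f : κ → ℕ}
    (hf : f.support.Finite) (hle : ∀ x, Nat.card {b // g b = x} ≤ f x) (s : Set κ) :
    Nat.card {b // g b ∈ s} ≤ ∑ᶠ x ∈ s, f x := by
  classical
  have := Fintype.ofFinite ι
  have hpos (b : ι) : f (g b) ≠ 0 :=
    (lt_of_lt_of_le (Nat.card_pos_iff.2 ⟨⟨b, rfl⟩, inferInstance⟩) (hle (g b))).ne'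
  rw [finsum_mem_eq_sum f (hf.inter_of_right s), Nat.card_eq_fintype_card,
    Fintype.card_subtype, Finset.card_eq_sum_card_fiberwise (f := g)
      (t := (hf.inter_of_right s).toFinset) fun b hb =>
        (Set.Finite.mem_toFinset _).2 ⟨(Finset.mem_filter.1 hb).2, hpos b⟩]
  refine Finset.sum_le_sum fun x _ => le_trans ?_ (hle x)
  rw [Nat.card_eq_fintype_card, Fintype.card_subtype, Finset.filter_filter]
  exact Finset.card_le_card (Finset.monotone_filter_right _ fun _ _ hb => hb.2)

variable {a} in
theorem finrank_tor_le_finsum {Γ : Type w} [AddCommMonoid Γ] {d : Fin n → Γ}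
    (ha : a ≤ idealOfVars (Fin n) k) (hd : IsHomogeneousFor d a)
    (R : GradedFreeResolution.{u, v, w} (algComponent d a) (augIdeal a)) (i : ℕ) (γ : Γ) :
    Module.Finite k (R.Tor i γ) ∧ Module.finrank k (R.Tor i γ) ≤
      ∑ᶠ α ∈ {α : Fin n →₀ ℕ | Finsupp.weight d α = γ},
        MvPowerSeries.coeff α (PowerSeries.coeff i (boundSeries a)) :=
  (LetterSystem.finrank_tor_le_card ha hd (attachedSystem a) R i γ).imp_right fun h =>
    h.trans (card_le_finsum_mem (fun c : (attachedSystem a).Cell i => c.1.sum)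
      (finite_support_boundSeries a i) (card_cells_le a i) {α | Finsupp.weight d α = γ})

end Series

theorem weight_naturalDegree {n : ℕ} (α : Fin n →₀ ℕ) :
    Finsupp.weight (naturalDegree n) α = α := by
  simp only [Finsupp.weight_apply, naturalDegree, Finsupp.smul_single, smul_eq_mul, mul_one,
    Finsupp.sum_single]

theorem coeff_poincareSeries {k A : Type u} [Field k] [CommRing A] [Algebra k A] {n : ℕ}
    {𝒜 : (Fin n →₀ ℕ) → Submodule k A} {𝔪 : Ideal A} (R : GradedFreeResolution.{u, v, 0} 𝒜 𝔪)
    (i : ℕ) (α : Fin n →₀ ℕ) :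
    MvPowerSeries.coeff α (PowerSeries.coeff i (poincareSeries R)) =
      Module.finrank k (R.Tor i α) :=
  congrArg (MvPowerSeries.coeff α) (PowerSeries.coeff_mk _ _)

end AnickCommutative

open AnickCommutative in
theorem corollary3p4 {k : Type u} [Field k] {n : ℕ}
    (a : Ideal (MvPolynomial (Fin n) k))
    (ha : a ≤ MvPolynomial.idealOfVars (Fin n) k) :
    -- `A` carries the natural multigrading
    (IsHomogeneousFor (naturalDegree n) a →
      ∀ R : GradedFreeResolution.{u, v, 0} (algComponent (naturalDegree n) a) (augIdeal a),
        (∀ (i : ℕ) (α : Fin n →₀ ℕ), Module.Finite k (R.Tor i α)) ∧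
        ∀ (i : ℕ) (α : Fin n →₀ ℕ),
          MvPowerSeries.coeff α (PowerSeries.coeff i (poincareSeries R)) ≤
            MvPowerSeries.coeff α (PowerSeries.coeff i (boundSeries a))) ∧
    -- `A` carries the grading `deg x_i = d i` by a commutative monoid
    (∀ i : ℕ, {α : Fin n →₀ ℕ |
        MvPowerSeries.coeff α (PowerSeries.coeff i (boundSeries a)) ≠ 0}.Finite) ∧
    (∀ {Γ : Type w} [AddCommMonoid Γ] (d : Fin n → Γ), IsHomogeneousFor d a →
      ∀ R : GradedFreeResolution.{u, v, w} (algComponent d a) (augIdeal a),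
      ∀ (i : ℕ) (γ : Γ),
        Module.Finite k (R.Tor i γ) ∧
        Module.finrank k (R.Tor i γ) ≤
          ∑ᶠ α ∈ {α : Fin n →₀ ℕ | Finsupp.weight d α = γ},
            MvPowerSeries.coeff α (PowerSeries.coeff i (boundSeries a))) := by
  refine ⟨fun hd R => ?_, finite_support_boundSeries a, fun d hd R => finrank_tor_le_finsum ha hd R⟩
  have htor := finrank_tor_le_finsum ha hd R
  refine ⟨fun i α => (htor i α).1, fun i α => ?_⟩
  have hfiber : {β : Fin n →₀ ℕ | Finsupp.weight (naturalDegree n) β = α} = {α} := by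
    simp only [weight_naturalDegree, Set.ofPred_eq_eq_singleton]
  have hle := (htor i α).2
  rwa [hfiber, finsum_mem_singleton, ← coeff_poincareSeries] at hle
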